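/- Let $R_0,\nu,C_0>0$, $\delta\in(1/2,1)$, $L=4R_0$ and $\Omega=[0,L]^3$ with periodic boundary conditions. Let $H$ be the space of $\Omega$-periodic, divergence-free, mean-zero fields in $L^2(\Omega;\mathbb R^3)$, with norm $\|\cdot\|$ and inner product $(\cdot,\cdot)$ of $L^2(\Omega)$; let $A=-\Delta$ be the Stokes operator on $H$, $V=D(A^{1/2})$ and $(B(u,v),w)=\int_\Omega ((u\cdot\nabla)v)\cdot w$. For a time-independent force $f\in H$, a Leray–Hopf solution on $[a,\infty)$ is a bounded, weakly continuous $u:[a,\infty)\to H$, with $u\in L^2_{loc}((a,\infty),V)$, such that for all $v\in V$, $\frac{d}{dt}(u,v)+\nu(A^{1/2}u,A^{1/2}v)-(B(u,v),u)=(f,v)$ in the sense of distributions on $(a,\infty)$, and such that, for a.e. $t_0\ge a$ and all $t_1\ge t_0$, $\nu\int_{t_0}^{t_1}\|\nabla u\|^2\le \frac12\|u(t_0)\|^2-\frac12\|u(t_1)\|^2+\int_{t_0}^{t_1}(f,u)$. The weak attractor $\mathcal A_w$ is the set of all values of functions $v:\mathbb R\to H$ that are bounded on $\mathbb R$ and are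 Leray–Hopf solutions on $[a,\infty)$ for every $a\in\mathbb R$. Let $\eta\in C^1(\mathbb R)$, $\eta\not\equiv0$, $0\le\eta\le1$, $\operatorname{supp}\eta\subseteq[0,T]$, $|\eta'|\le \frac{C_0}{T}\eta^\delta$, and $c_\eta=\frac1T\int_0^T\eta$. For a Leray–Hopf solution $u$ on $[0,\infty)$ put $$e_0=\frac1T\frac1{R_0^3}\int_0^T\eta^\delta\frac{\|u\|^2}2,\qquad \varepsilon_0=\frac1T\frac1{R_0^3}\,\nu\int_0^T\eta\|\nabla u\|^2+\varepsilon_\infty,$$ where the anomalous dissipation $\varepsilon_\infty$ is determined by the energy balance $$\varepsilon_0=\frac1T\frac1{R_0^3}\int_0^T\eta'\frac{\|u\|^2}2+\frac1T\frac1{R_0^3}\int_0^T\eta\,(f,u).$$ There is an absolute constant $C>0$ such that Agmon's inequality $\|w\|_\infty\le C\|A^{1/2}w\|^{1/2}\|Aw\|^{1/2}$ holds for all $w\in D(A)$ and all $L>0$. Let $C_A>0$ be any constant for which it holds on $\Omega$, and put $$\gamma_f=\frac{C_0}{\nu T}\frac{\|A^{-1}f\|}{\|f\|}+1,\quad c_1=\frac{2C_0}{\pi^2},\quad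 \sigma_f=\frac{2\gamma_f^2\nu^2}{c_\eta C_A}\frac{\|f\|^{1/2}}{\|A^{1/2}f\|^{1/2}}\frac{\|f\|^2}{\|A^{-1/2}f\|^2},\quad \theta_f=\frac{c_\eta}{4C_A}\frac1{R_0^{5/2}}\frac{\|A^{-1/2}f\|^2}{\|f\|^{3/2}\|A^{1/2}f\|^{1/2}}.$$ **Theorem.** Assume $0\ne f\in D(A^{1/2})$, $u$ is a Leray–Hopf solution on $[0,\infty)$ with $u(t)\in\mathcal A_w$ for all $t\in[0,T]$, $\|f\|\ge\sigma_f$ and $T\ge c_1R_0^2/\nu$. Then $\varepsilon_\infty\ge0$ and $$\varepsilon_0\le2\sqrt2\,\frac{\|f\|}{R_0^{3/2}}\,e_0^{1/2},\qquad e_0\ge\theta_f\frac{\|f\|}{R_0^{1/2}},\qquad \varepsilon_0\le\frac{2\sqrt2}{\theta_f}\frac{e_0^{3/2}}{R_0}.$$ -/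

import Mathlib

noncomputable section

namespace NSE

open MeasureTheory Set

/-- The periodic box `[0,L]³` with opposite faces identified; its `volume` has total mass `L³`. -/
abbrev Torus (L : ℝ) : Type := Fin 3 → AddCircle L

/-- `L²([0,L]³; ℝ³)`, a real Hilbert space with `⟪u, v⟫ = ∫ u · v`. -/
abbrev VecField (L : ℝ) [Fact (0 < L)] : Type :=
  Lp (EuclideanSpace ℝ (Fin 3)) 2 (volume : Measure (Torus L))

section

variable {L : ℝ} [Fact (0 < L)]

/-- The character `x ↦ exp (2πi k·x / L)` of the box. -/
def mode (k : Fin 3 → ℤ) (x : Torus L) : ℂ := ∏ i, fourier (k i) (x i)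

/-- The `k`-th Fourier coefficient of the `j`-th component of `u`. -/
def coef (u : VecField L) (j : Fin 3) (k : Fin 3 → ℤ) : ℂ :=
  (1 / (L : ℂ) ^ 3) * ∫ x : Torus L, (starRingEnd ℂ) (mode k x) * ((u x j : ℝ) : ℂ)

/-- The `i`-th component `2π kᵢ / L` of the wave vector. -/
def wave (L : ℝ) (k : Fin 3 → ℤ) (i : Fin 3) : ℝ := 2 * Real.pi * (k i : ℝ) / L

/-- The eigenvalue `|2πk/L|²` of `-Δ` on the `k`-th mode. -/
def eigen (L : ℝ) (k : Fin 3 → ℤ) : ℝ := ∑ i, wave L k i ^ 2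

variable (L) in
/-- The space `H`: mean-zero fields whose weak divergence vanishes (tested against characters). -/
def H : Set (VecField L) :=
  {u | (∀ j, coef u j 0 = 0) ∧ ∀ k, ∑ j, ((wave L k j : ℝ) : ℂ) * coef u j k = 0}

/-- `w = A ^ s u`, where `A = -Δ` is the Stokes operator on `H` (diagonal in the Fourier basis). -/
def IsStokesPow (s : ℝ) (u w : VecField L) : Prop :=
  u ∈ H L ∧ w ∈ H L ∧ ∀ k j, coef w j k = ((eigen L k ^ s : ℝ) : ℂ) * coef u j k

variable (L) in
/-- The domain `D(A ^ s)`. -/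
def stokesDom (s : ℝ) : Set (VecField L) := {u | ∃ w, IsStokesPow s u w}

open Classical in
/-- `A ^ s u` (and `0` outside the domain `D(A ^ s)`). -/
def stokesPow (s : ℝ) (u : VecField L) : VecField L :=
  if h : ∃ w, IsStokesPow s u w then h.choose else 0

variable (L) in
/-- The space `V = D(A^{1/2})`. -/
def V : Set (VecField L) := stokesDom L (1 / 2)

/-- `w ∈ L²` is the weak derivative `∂ᵢ u` (integration by parts against every character). -/
def IsWeakPartial (i : Fin 3) (u w : VecField L) : Prop :=
  ∀ k j, coef w j k = Complex.I * ((wave L k i : ℝ) : ℂ) * coef u j k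

open Classical in
/-- The weak derivative `∂ᵢ u ∈ L²` (and `0` if it does not exist). -/
def weakPartial (i : Fin 3) (u : VecField L) : VecField L :=
  if h : ∃ w, IsWeakPartial i u w then h.choose else 0

/-- `‖∇u‖²`, the squared `L²` norm of the gradient. -/
def gradSq (u : VecField L) : ℝ := ∑ i, ‖weakPartial i u‖ ^ 2

/-- `(B(u,v),w) = ∫ ((u·∇)v)·w`. -/
def trilinear (u v w : VecField L) : ℝ :=
  ∫ x : Torus L, inner ℝ (∑ i, (u x i) • (weakPartial i v x)) (w x)

/-- `u` is a Leray–Hopf weak solution of the periodic Navier–Stokes equations on `[a,∞)`, with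
viscosity `ν` and time-independent force `f`. -/
structure IsLerayHopf (ν : ℝ) (f : VecField L) (a : ℝ) (u : ℝ → VecField L) : Prop where
  mem_H : ∀ t, a ≤ t → u t ∈ H L
  weak_continuous : ∀ v : VecField L, ContinuousOn (fun t => inner ℝ (u t) v) (Ici a)
  bounded : ∃ M : ℝ, ∀ t, a ≤ t → ‖u t‖ ≤ M
  mem_V : ∀ᵐ t ∂(volume.restrict (Ioi a)), u t ∈ V L
  grad_sq_integrable : LocallyIntegrableOn (fun t => gradSq (u t)) (Ioi a)
  /-- `d/dt (u,v) + ν (A^{1/2}u, A^{1/2}v) - (B(u,v),u) = (f,v)` in the sense of distributions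
  on `(a,∞)`, for all `v ∈ V`. -/
  weak_form : ∀ v ∈ V L, ∀ φ : ℝ → ℝ, ContDiff ℝ (⊤ : ℕ∞) φ → HasCompactSupport φ →
    tsupport φ ⊆ Ioi a →
    -(∫ t, deriv φ t * inner ℝ (u t) v)
      + ν * (∫ t, φ t * inner ℝ (stokesPow (1 / 2) (u t)) (stokesPow (1 / 2) v))
      - (∫ t, φ t * trilinear (u t) v (u t))
      = ∫ t, φ t * inner ℝ f v
  energy_ineq : ∀ᵐ t₀ ∂(volume.restrict (Ioi a)), ∀ t₁, t₀ ≤ t₁ →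
    ν * (∫ t in t₀..t₁, gradSq (u t))
      ≤ ‖u t₀‖ ^ 2 / 2 - ‖u t₁‖ ^ 2 / 2 + ∫ t in t₀..t₁, inner ℝ f (u t)

/-- The weak global attractor: the points on the Leray–Hopf solutions that exist for all times
`t ∈ ℝ` and are bounded in `H` on the whole of `ℝ`. -/
def weakAttractor (ν : ℝ) (f : VecField L) : Set (VecField L) :=
  {w | ∃ v : ℝ → VecField L, (∀ a, IsLerayHopf ν f a v) ∧ (∃ M : ℝ, ∀ t, ‖v t‖ ≤ M) ∧ v 0 = w}

/-- A refined time cut-off on `[0,T]` with parameters `C₀` and `δ`. -/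
structure IsTimeCutoff (C₀ δ T : ℝ) (η : ℝ → ℝ) : Prop where
  contDiff : ContDiff ℝ 1 η
  nonneg : ∀ t, 0 ≤ η t
  le_one : ∀ t, η t ≤ 1
  support : tsupport η ⊆ Icc 0 T
  deriv_bound : ∀ t, |deriv η t| ≤ C₀ / T * η t ^ δ

/-- The global energy `e₀`. -/
def energy (R₀ T δ : ℝ) (η : ℝ → ℝ) (u : ℝ → VecField L) : ℝ :=
  1 / T * (1 / R₀ ^ 3) * ∫ t in (0 : ℝ)..T, η t ^ δ * (‖u t‖ ^ 2 / 2)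

/-- The viscous dissipation rate. -/
def viscousDissipation (ν R₀ T : ℝ) (η : ℝ → ℝ) (u : ℝ → VecField L) : ℝ :=
  1 / T * (1 / R₀ ^ 3) * (ν * ∫ t in (0 : ℝ)..T, η t * gradSq (u t))

/-- The anomalous dissipation rate `ε_∞`: the defect in the energy balance. -/
def anomalousDissipation (ν R₀ T : ℝ) (f : VecField L) (η : ℝ → ℝ) (u : ℝ → VecField L) : ℝ :=
  1 / T * (1 / R₀ ^ 3) * (∫ t in (0 : ℝ)..T, deriv η t * (‖u t‖ ^ 2 / 2))
    + 1 / T * (1 / R₀ ^ 3) * (∫ t in (0 : ℝ)..T, η t * inner ℝ f (u t))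
    - viscousDissipation ν R₀ T η u

/-- The total (viscous and anomalous) dissipation rate `ε₀`. -/
def dissipation (ν R₀ T : ℝ) (f : VecField L) (η : ℝ → ℝ) (u : ℝ → VecField L) : ℝ :=
  viscousDissipation ν R₀ T η u + anomalousDissipation ν R₀ T f η u

variable (L) in
/-- Agmon's inequality `‖w‖_∞ ≤ C ‖A^{1/2}w‖^{1/2} ‖Aw‖^{1/2}` on `D(A)`, with constant `C`. -/
def AgmonInequality (C : ℝ) : Prop :=
  ∀ w ∈ stokesDom L 1, ∀ᵐ x : Torus L,
    ‖w x‖ ≤ C * ‖stokesPow (1 / 2) w‖ ^ (1 / 2 : ℝ) * ‖stokesPow 1 w‖ ^ (1 / 2 : ℝ)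

/-- The time average of the cut-off. -/
def cEta (T : ℝ) (η : ℝ → ℝ) : ℝ := 1 / T * ∫ t in (0 : ℝ)..T, η t

def gammaF (ν C₀ T : ℝ) (f : VecField L) : ℝ :=
  C₀ / (ν * T) * (‖stokesPow (-1) f‖ / ‖f‖) + 1

def sigmaF (ν C₀ C_A T : ℝ) (η : ℝ → ℝ) (f : VecField L) : ℝ :=
  2 * gammaF ν C₀ T f ^ 2 * ν ^ 2 / (cEta T η * C_A)
    * (‖f‖ ^ (1 / 2 : ℝ) / ‖stokesPow (1 / 2) f‖ ^ (1 / 2 : ℝ))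
    * (‖f‖ ^ 2 / ‖stokesPow (-(1 / 2)) f‖ ^ 2)

def thetaF (R₀ C_A T : ℝ) (η : ℝ → ℝ) (f : VecField L) : ℝ :=
  cEta T η / (4 * C_A) * (1 / R₀ ^ (5 / 2 : ℝ))
    * (‖stokesPow (-(1 / 2)) f‖ ^ 2
        / (‖f‖ ^ (3 / 2 : ℝ) * ‖stokesPow (1 / 2) f‖ ^ (1 / 2 : ℝ)))

end

end NSE

end

/-! Upper bound on the dissipation. In `dissipation` the viscous term cancels, so it equals the
averages of `η' ‖u‖²/2` and `η (f,u)`. With `x` the `η^δ`-weighted root mean square of `‖u‖`, the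
cut-off condition bounds the first by a multiple of `x²` and Cauchy–Schwarz bounds the second by a
multiple of `‖f‖ x`. On the weak attractor `‖u‖` obeys the absorbing bound `‖f‖ / (ν λ₁)`, and the
lower bound on `T` is what lets one factor `x` of the quadratic term be absorbed into `‖f‖`. Carried
by `norm_le_of_mem_weakAttractor` and `dissipation_le_rmsNorm`.

Lower bound on the energy. Test the weak equation with `η A⁻¹f`. The force contributes `‖A^{-1/2}f‖²
∫ η`; the time derivative and the viscosity are linear in `‖u‖`, and the nonlinearity is quadratic,
because Agmon's inequality bounds `∇A⁻¹f` in `L^∞`. This gives `D ≤ P x + F x²` (`weak_form_bound`),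
and `‖f‖ ≥ σ_f` says exactly that `2P² ≤ D F`, so the quadratic term must carry at least half of `D`
(`le_sq_of_quadratic`). The last estimate of the theorem eliminates `‖f‖` between the two bounds.

Nonnegativity of `ε_∞` is the weak-in-time form of the energy inequality: the energy minus the
accumulated work and viscous loss is almost everywhere nonincreasing. Agmon's inequality with a
constant independent of `L` is proved from the Fourier side, as an `ℓ¹` bound on coefficients by
weighted Cauchy–Schwarz and lattice counting. -/

noncomputable section

namespace NSE

open MeasureTheory Set Filter Topology
open scoped ComplexConjugate ENNReal

/-! ### Fourier series on the box: completeness, Parseval, Riesz–Fischer. -/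

section Fourier

variable {L : ℝ}

/-- The character `mode k` as a continuous map. -/
def modeC (L : ℝ) (k : Fin 3 → ℤ) : C(Torus L, ℂ) where
  toFun := mode k
  continuous_toFun := by unfold mode; fun_prop

lemma modeC_apply (k : Fin 3 → ℤ) (x : Torus L) : modeC L k x = mode k x := rfl

lemma mode_neg (k : Fin 3 → ℤ) (x : Torus L) : mode (-k) x = conj (mode k x) := by
  simp only [mode, Pi.neg_apply, fourier_neg, map_prod]

lemma mode_add (k l : Fin 3 → ℤ) (x : Torus L) : mode (k + l) x = mode k x * mode l x := by
  simp only [mode, Pi.add_apply, fourier_add, ← Finset.prod_mul_distrib]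

lemma mode_zero (x : Torus L) : mode 0 x = 1 := by
  simp [mode]

lemma norm_mode (k : Fin 3 → ℤ) (x : Torus L) : ‖mode k x‖ = 1 := by
  simp only [mode, fourier_apply, norm_prod, Circle.norm_coe, Finset.prod_const_one]

lemma mode_single (z : Torus L) (i : Fin 3) :
    mode (Pi.single i 1) z = fourier 1 (z i) := by
  rw [mode, Finset.prod_eq_single i]
  · simp
  · intro j _ hj
    simp [Pi.single_eq_of_ne hj]
  · simp

variable [Fact (0 < L)]

variable (L) in
/-- The star subalgebra of `C(Torus L, ℂ)` generated by the characters. -/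
def modeSubalgebra : StarSubalgebra ℂ C(Torus L, ℂ) where
  toSubalgebra := Algebra.adjoin ℂ (range (modeC L))
  star_mem' := by
    change Algebra.adjoin ℂ (range (modeC L)) ≤ star (Algebra.adjoin ℂ (range (modeC L)))
    refine Algebra.adjoin_le ?_
    rintro _ ⟨n, rfl⟩
    refine Algebra.subset_adjoin ⟨-n, ?_⟩
    ext1 x
    simp only [modeC_apply, mode_neg, starRingEnd_apply, ContinuousMap.star_apply]

variable (L) in
-- Products of characters are characters, so the span is already an algebra.
lemma modeSubalgebra_coe :
    Subalgebra.toSubmodule (modeSubalgebra L).toSubalgebra = Submodule.span ℂ (range (modeC L)) := by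
  apply Algebra.adjoin_eq_span_of_subset
  refine .trans (fun x ↦ Submonoid.closure_induction (fun _ ↦ id) ⟨0, ?_⟩ ?_) Submodule.subset_span
  · ext z
    simp [modeC_apply, mode_zero]
  · rintro _ _ _ _ ⟨m, rfl⟩ ⟨n, rfl⟩
    refine ⟨m + n, ?_⟩
    ext z
    simp [modeC_apply, mode_add]

variable (L) in
lemma modeSubalgebra_separatesPoints : (modeSubalgebra L).SeparatesPoints := by
  intro x y hxy
  rw [Ne, funext_iff, not_forall] at hxy
  obtain ⟨i, hi⟩ := hxy
  refine ⟨_, ⟨modeC L (Pi.single i 1), Algebra.subset_adjoin ⟨Pi.single i 1, rfl⟩, rfl⟩, ?_⟩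
  dsimp only
  rw [modeC_apply, modeC_apply, mode_single, mode_single, fourier_one, fourier_one, Ne,
    Circle.coe_inj]
  contrapose hi
  exact AddCircle.injective_toCircle (Fact.out : 0 < L).ne' hi

variable (L) in
-- Stone–Weierstrass for the self-adjoint, point-separating algebra of trigonometric polynomials.
lemma span_modeC_closure_eq_top :
    (Submodule.span ℂ (range (modeC L))).topologicalClosure = ⊤ := by
  rw [← modeSubalgebra_coe]
  exact congr_arg (Subalgebra.toSubmodule <| StarSubalgebra.toSubalgebra ·)
    (ContinuousMap.starSubalgebra_topologicalClosure_eq_top_of_separatesPoints _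
      (modeSubalgebra_separatesPoints L))

/-- The measure has total mass `L ^ 3` rather than `1`; this is the source of the factors `√(L ^ 3)`
in the orthonormal basis. -/
lemma integral_mode (k : Fin 3 → ℤ) :
    ∫ x : Torus L, mode k x = if k = 0 then (L : ℂ) ^ 3 else 0 := by
  unfold mode
  rw [MeasureTheory.integral_fintype_prod_volume_eq_prod]
  have h1 : ∀ n : ℤ, ∫ x : AddCircle L, fourier n x = if n = 0 then (L : ℂ) else 0 := by
    intro n
    have h := (orthonormal_iff_ite.mp (orthonormal_fourier (T := L))) 0 n
    simp only [ContinuousMap.inner_toLp, fourier_zero, map_one, mul_one] at h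
    rw [AddCircle.volume_eq_smul_haarAddCircle, integral_smul_measure, h,
      ENNReal.toReal_ofReal (Fact.out : 0 < L).le]
    split_ifs with h1 h2 h2
    · simp
    · exact absurd h1.symm h2
    · exact absurd h2.symm h1
    · simp
  simp only [h1]
  split_ifs with h
  · simp [h]
  · obtain ⟨i, hi⟩ := Function.ne_iff.mp h
    exact Finset.prod_eq_zero (Finset.mem_univ i) (if_neg hi)

variable (L) in
/-- The normalized characters as elements of complex `L²`. -/
def modeLp (k : Fin 3 → ℤ) : Lp ℂ 2 (volume : Measure (Torus L)) :=
  ((√(L ^ 3))⁻¹ : ℂ) • ContinuousMap.toLp (E := ℂ) 2 volume ℂ (modeC L k)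

variable (L) in
lemma sqrt_cube_ne_zero : ((√(L ^ 3) : ℝ) : ℂ) ≠ 0 := by
  have := (Fact.out : 0 < L)
  exact_mod_cast (Real.sqrt_pos.2 (by positivity)).ne'

variable (L) in
lemma sqrt_cube_mul_self : ((√(L ^ 3) : ℝ) : ℂ) * ((√(L ^ 3) : ℝ) : ℂ) = (L : ℂ) ^ 3 := by
  have := (Fact.out : 0 < L)
  rw [← Complex.ofReal_mul, Real.mul_self_sqrt (by positivity)]
  push_cast; rfl

variable (L) in
lemma orthonormal_modeLp : Orthonormal ℂ (modeLp L) := by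
  rw [orthonormal_iff_ite]
  intro m n
  have h : ∀ x : Torus L, mode n x * conj (mode m x) = mode (n - m) x := by
    intro x
    rw [← mode_neg, ← mode_add, sub_eq_add_neg]
  simp only [modeLp, inner_smul_left, inner_smul_right, ContinuousMap.inner_toLp, modeC_apply, h,
    integral_mode, sub_eq_zero]
  have h1 := sqrt_cube_ne_zero L
  rw [← sqrt_cube_mul_self]
  by_cases hmn : m = n
  · simp only [hmn, if_true]
    rw [map_inv₀, Complex.conj_ofReal]
    field_simp
  · simp [hmn, Ne.symm hmn]

variable (L) in
lemma span_modeLp_closure_eq_top :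
    (Submodule.span ℂ (range (modeLp L))).topologicalClosure = ⊤ := by
  have h0 : (Submodule.span ℂ (range fun k =>
      ContinuousMap.toLp (E := ℂ) 2 (volume : Measure (Torus L)) ℂ (modeC L k))).topologicalClosure
        = ⊤ := by
    simpa only [Submodule.map_span, ContinuousLinearMap.coe_coe, ← range_comp, Function.comp_def]
      using (ContinuousMap.toLp_denseRange ℂ (volume : Measure (Torus L)) ℂ
        (p := 2) (by simp)).topologicalClosure_map_submodule (span_modeC_closure_eq_top L)
  rw [eq_top_iff, ← h0]
  apply Submodule.topologicalClosure_mono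
  rw [Submodule.span_le]
  rintro _ ⟨k, rfl⟩
  have : ContinuousMap.toLp (E := ℂ) 2 (volume : Measure (Torus L)) ℂ (modeC L k)
      = ((√(L ^ 3) : ℝ) : ℂ) • modeLp L k := by
    rw [modeLp, smul_smul, mul_inv_cancel₀ (sqrt_cube_ne_zero L), one_smul]
  simp only [SetLike.mem_coe]
  rw [this]
  exact Submodule.smul_mem _ _ (Submodule.subset_span ⟨k, rfl⟩)

variable (L) in
/-- The Fourier basis of complex `L²`. -/
def modeBasis : HilbertBasis (Fin 3 → ℤ) ℂ (Lp ℂ 2 (volume : Measure (Torus L))) :=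
  HilbertBasis.mk (orthonormal_modeLp L) (span_modeLp_closure_eq_top L).ge

variable (L) in
@[simp]
lemma coe_modeBasis : ⇑(modeBasis L) = modeLp L := HilbertBasis.coe_mk _ _

/-- The complexified `j`-th component. -/
def comp (j : Fin 3) (u : VecField L) : Lp ℂ 2 (volume : Measure (Torus L)) :=
  (Complex.ofRealCLM.comp (EuclideanSpace.proj j : EuclideanSpace ℝ (Fin 3) →L[ℝ] ℝ)).compLp u

lemma coeFn_comp (j : Fin 3) (u : VecField L) :
    comp j u =ᵐ[volume] fun x => ((u x j : ℝ) : ℂ) := by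
  filter_upwards [ContinuousLinearMap.coeFn_compLp (Complex.ofRealCLM.comp
    (EuclideanSpace.proj j : EuclideanSpace ℝ (Fin 3) →L[ℝ] ℝ)) u] with x hx
  simpa [comp] using hx

lemma inner_modeLp (k : Fin 3 → ℤ) (g : Lp ℂ 2 (volume : Measure (Torus L))) :
    inner ℂ (modeLp L k) g = ((√(L ^ 3) : ℝ) : ℂ)⁻¹ * ∫ x, conj (mode k x) * g x := by
  rw [modeLp, inner_smul_left, MeasureTheory.L2.inner_def, map_inv₀, Complex.conj_ofReal]
  congr 1
  apply integral_congr_ae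
  filter_upwards [ContinuousMap.coeFn_toLp (p := 2) (𝕜 := ℂ) volume (modeC L k)] with x hx
  rw [hx, RCLike.inner_apply, mul_comm]
  rfl

/-- Translates between the unitary normalization of `modeBasis` and the averaged one of `coef`. -/
lemma repr_comp (j : Fin 3) (u : VecField L) (k : Fin 3 → ℤ) :
    (modeBasis L).repr (comp j u) k = ((√(L ^ 3) : ℝ) : ℂ) * coef u j k := by
  rw [HilbertBasis.repr_apply_apply, coe_modeBasis, inner_modeLp, coef, ← sqrt_cube_mul_self]
  have h1 := sqrt_cube_ne_zero L
  have : ∫ x, conj (mode k x) * (comp j u) x = ∫ x, conj (mode k x) * ((u x j : ℝ) : ℂ) := by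
    apply integral_congr_ae
    filter_upwards [coeFn_comp j u] with x hx
    rw [hx]
  rw [this]
  field_simp

lemma inner_comp (j : Fin 3) (u v : VecField L) :
    HasSum (fun k => (L : ℂ) ^ 3 * (conj (coef u j k) * coef v j k))
      (inner ℂ (comp j u) (comp j v)) := by
  refine ((modeBasis L).hasSum_inner_mul_inner (comp j u) (comp j v)).congr_fun fun k => ?_
  rw [← inner_conj_symm (comp j u), ← HilbertBasis.repr_apply_apply,
    ← HilbertBasis.repr_apply_apply, repr_comp, repr_comp, map_mul, Complex.conj_ofReal,
    ← sqrt_cube_mul_self]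
  ring

lemma inner_eq_sum_comp (u v : VecField L) :
    inner ℝ u v = ∑ j, (inner ℂ (comp j u) (comp j v)).re := by
  have h : ∀ j, inner ℂ (comp j u) (comp j v) = ((∫ x, u x j * v x j : ℝ) : ℂ) := by
    intro j
    rw [MeasureTheory.L2.inner_def, ← integral_complex_ofReal]
    apply integral_congr_ae
    filter_upwards [coeFn_comp j u, coeFn_comp j v] with x h1 h2
    rw [h1, h2, RCLike.inner_apply, Complex.conj_ofReal]
    push_cast
    ring
  simp only [h, Complex.ofReal_re]
  rw [MeasureTheory.L2.inner_def, ← integral_finsetSum]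
  · apply integral_congr_ae
    filter_upwards with x
    rw [PiLp.inner_apply]
    simp [mul_comm]
  · intro j _
    have hm : ∀ w : VecField L, MemLp (fun x => w x j) 2 volume := fun w =>
      (EuclideanSpace.proj j : EuclideanSpace ℝ (Fin 3) →L[ℝ] ℝ).comp_memLp' (Lp.memLp w)
    exact (hm u).integrable_mul (hm v)

/-- **Parseval's identity** for the inner product of vector fields. -/
lemma hasSum_inner (u v : VecField L) :
    HasSum (fun k => L ^ 3 * ∑ j, (conj (coef u j k) * coef v j k).re) (inner ℝ u v) := by
  have h : ∀ j, HasSum (fun k => L ^ 3 * (conj (coef u j k) * coef v j k).re)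
      (inner ℂ (comp j u) (comp j v)).re := by
    intro j
    refine (Complex.hasSum_re (inner_comp j u v)).congr_fun fun k => ?_
    rw [← Complex.ofReal_pow, Complex.re_ofReal_mul]
  rw [inner_eq_sum_comp]
  simp only [Finset.mul_sum]
  exact hasSum_sum fun j _ => h j

/-- **Parseval's identity** for the norm of vector fields. -/
lemma hasSum_norm_sq (u : VecField L) :
    HasSum (fun k => L ^ 3 * ∑ j, ‖coef u j k‖ ^ 2) (‖u‖ ^ 2) := by
  rw [← real_inner_self_eq_norm_sq]
  refine (hasSum_inner u u).congr_fun fun k => ?_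
  congr 1
  refine Finset.sum_congr rfl fun j _ => ?_
  rw [mul_comm, Complex.mul_conj, Complex.ofReal_re, Complex.normSq_eq_norm_sq]

lemma summable_sum_coef_sq (u : VecField L) : Summable fun k => ∑ j, ‖coef u j k‖ ^ 2 := by
  have hL : (L ^ 3 : ℝ) ≠ 0 := pow_ne_zero _ (Fact.out : 0 < L).ne'
  exact (summable_mul_left_iff hL).1 (hasSum_norm_sq u).summable

/-- The coefficients of a real field are conjugate symmetric. -/
lemma coef_neg (u : VecField L) (j : Fin 3) (k : Fin 3 → ℤ) :
    coef u j (-k) = conj (coef u j k) := by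
  rw [coef, coef, map_mul, ← integral_conj]
  congr 1
  · simp
  · refine integral_congr_ae (.of_forall fun x => ?_)
    simp [mode_neg]

/-- A field is determined by its coefficients. -/
lemma coef_ext {u v : VecField L} (h : ∀ j k, coef u j k = coef v j k) : u = v := by
  have h1 : inner ℝ (u - v) u = inner ℝ (u - v) v :=
    (hasSum_inner (u - v) u).unique (by simpa only [h] using hasSum_inner (u - v) v)
  rw [← sub_eq_zero, ← inner_self_eq_zero (𝕜 := ℝ), inner_sub_right, h1, sub_self]

lemma euclidean_norm_le_sum (y : EuclideanSpace ℝ (Fin 3)) : ‖y‖ ≤ ∑ j, |y j| := by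
  rw [EuclideanSpace.norm_eq]
  apply Real.sqrt_le_iff.2
  refine ⟨by positivity, ?_⟩
  simp only [Real.norm_eq_abs]
  exact Finset.sum_sq_le_sq_sum_of_nonneg fun j _ => abs_nonneg _

/-- A field with absolutely summable coefficients is essentially bounded by their sum. -/
lemma ae_norm_le_tsum_coef (u : VecField L) (hs : ∀ j, Summable fun k => ‖coef u j k‖) :
    ∀ᵐ x : Torus L, ‖u x‖ ≤ ∑ j, ∑' k, ‖coef u j k‖ := by
  have key : ∀ j, ∀ᵐ x : Torus L, |u x j| ≤ ∑' k, ‖coef u j k‖ := by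
    intro j
    have hn : ∀ k, ‖coef u j k • modeC L k‖ ≤ ‖coef u j k‖ := by
      intro k
      refine (norm_smul_le _ _).trans (mul_le_of_le_one_right (norm_nonneg _) ?_)
      exact (ContinuousMap.norm_le _ zero_le_one).2 fun x => (norm_mode k x).le
    have hsum : Summable fun k => coef u j k • modeC L k := Summable.of_norm_bounded (hs j) hn
    set g : C(Torus L, ℂ) := ∑' k, coef u j k • modeC L k
    have h1 := ((ContinuousMap.toLp (E := ℂ) 2 (volume : Measure (Torus L)) ℂ).hasSum hsum.hasSum)
    have h2 := (modeBasis L).hasSum_repr (comp j u)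
    -- The absolutely convergent series has a continuous sum, and its `L²` limit is unique, so this
    -- sum represents the component.
    have h3 : comp j u = ContinuousMap.toLp (E := ℂ) 2 (volume : Measure (Torus L)) ℂ g := by
      refine h2.unique (h1.congr_fun fun k => ?_)
      rw [repr_comp, coe_modeBasis, modeLp, smul_smul, map_smul, mul_right_comm,
        mul_inv_cancel₀ (sqrt_cube_ne_zero L), one_mul]
    have hg : ‖g‖ ≤ ∑' k, ‖coef u j k‖ := tsum_of_norm_bounded (hs j).hasSum hn
    filter_upwards [coeFn_comp j u, ContinuousMap.coeFn_toLp (p := 2) (𝕜 := ℂ) volume g]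
      with x hx hx'
    rw [h3, hx'] at hx
    have := (g.norm_coe_le_norm x).trans hg
    rwa [hx, Complex.norm_real, Real.norm_eq_abs] at this
  filter_upwards [ae_all_iff.2 key] with x hx
  exact (euclidean_norm_le_sum _).trans (Finset.sum_le_sum fun j _ => hx j)

/-- **Riesz–Fischer**: square-summable conjugate-symmetric coefficients are those of a field. -/
lemma exists_of_coef (c : Fin 3 → (Fin 3 → ℤ) → ℂ) (hc : ∀ j k, c j (-k) = conj (c j k))
    (hs : ∀ j, Summable fun k => ‖c j k‖ ^ 2) : ∃ u : VecField L, ∀ j k, coef u j k = c j k := by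
  have hmem : ∀ j, Memℓp (fun k => ((√(L ^ 3) : ℝ) : ℂ) * c j k) 2 := by
    intro j
    refine memℓp_gen ?_
    have := (hs j).mul_left (‖((√(L ^ 3) : ℝ) : ℂ)‖ ^ 2)
    simpa [mul_pow] using this
  set g : Fin 3 → Lp ℂ 2 (volume : Measure (Torus L)) :=
    fun j => (modeBasis L).repr.symm ⟨_, hmem j⟩ with hg
  have hgc : ∀ j k, ∫ x, conj (mode k x) * g j x = (L : ℂ) ^ 3 * c j k := by
    intro j k
    have h1 : (modeBasis L).repr (g j) k = ((√(L ^ 3) : ℝ) : ℂ) * c j k := by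
      simp [hg]
    rw [HilbertBasis.repr_apply_apply, coe_modeBasis, inner_modeLp,
      inv_mul_eq_iff_eq_mul₀ (sqrt_cube_ne_zero L), ← mul_assoc, sqrt_cube_mul_self] at h1
    exact h1
  -- The field is built from the real parts of the complex `L²` functions; conjugate symmetry of `c`
  -- guarantees that taking real parts leaves the coefficients unchanged.
  let T : Fin 3 → ℂ →L[ℝ] EuclideanSpace ℝ (Fin 3) := fun j =>
    (ContinuousLinearMap.toSpanSingleton ℝ (EuclideanSpace.single j (1 : ℝ))).comp Complex.reCLM
  let u : VecField L := ∑ j, (T j).compLp (g j)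
  have hu : ∀ᵐ x : Torus L, ∀ j, u x j = (g j x).re := by
    have h1 := Lp.coeFn_finsetSum Finset.univ fun j => (T j).compLp (g j)
    have h2 : ∀ᵐ x : Torus L, ∀ j, (T j).compLp (g j) x = T j (g j x) :=
      ae_all_iff.2 fun j => ContinuousLinearMap.coeFn_compLp _ _
    filter_upwards [h1, h2] with x h1 h2 j
    have h3 : u x = ∑ i, T i (g i x) := by
      rw [h1, Finset.sum_apply]
      exact Finset.sum_congr rfl fun i _ => h2 i
    rw [h3]
    simp [T, Finset.sum_apply, Pi.single_apply]
  refine ⟨u, fun j k => ?_⟩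
  have hi : ∀ k, Integrable (fun x => conj (mode k x) * g j x) (volume : Measure (Torus L)) := by
    intro k
    have h1 : Integrable (g j) (volume : Measure (Torus L)) :=
      (Lp.memLp (g j)).integrable (by norm_num)
    refine h1.bdd_mul (c := 1) ?_ (.of_forall fun x => ?_)
    · exact (Complex.continuous_conj.comp (modeC L k).continuous).aestronglyMeasurable
    · rw [RCLike.norm_conj, norm_mode]
  have h4 : ∫ x, conj (mode k x) * ((u x j : ℝ) : ℂ)
      = (1 / 2) * (∫ x, conj (mode k x) * g j x)
        + (1 / 2) * conj (∫ x, conj (mode (-k) x) * g j x) := by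
    rw [← integral_conj, ← integral_const_mul, ← integral_const_mul, ← integral_add]
    · apply integral_congr_ae
      filter_upwards [hu] with x hx
      rw [hx j, Complex.re_eq_add_conj]
      simp only [mode_neg, map_mul, Complex.conj_conj]
      ring
    · exact (hi k).const_mul _
    · refine Integrable.const_mul ?_ _
      exact (Complex.conjCLE : ℂ →L[ℝ] ℂ).integrable_comp (hi (-k))
  rw [coef, h4, hgc, hgc, hc, map_mul, Complex.conj_conj, map_pow, Complex.conj_ofReal]
  have : (L : ℂ) ≠ 0 := by exact_mod_cast (Fact.out : 0 < L).ne'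
  field_simp
  rw [one_add_one_eq_two, mul_comm]

end Fourier

/-! ### Stokes powers, derivatives and the nonlinear term as Fourier multipliers. -/

section Stokes

variable {L : ℝ} [Fact (0 < L)]

lemma eigen_nonneg (L : ℝ) (k : Fin 3 → ℤ) : 0 ≤ eigen L k :=
  Finset.sum_nonneg fun _ _ => sq_nonneg _

lemma eigen_neg (L : ℝ) (k : Fin 3 → ℤ) : eigen L (-k) = eigen L k := by
  simp [eigen, wave, neg_div]

lemma wave_neg (L : ℝ) (k : Fin 3 → ℤ) (i : Fin 3) : wave L (-k) i = -wave L k i := by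
  simp [wave, neg_div]

lemma wave_sq_le_eigen (L : ℝ) (k : Fin 3 → ℤ) (i : Fin 3) : wave L k i ^ 2 ≤ eigen L k :=
  Finset.single_le_sum (f := fun i => wave L k i ^ 2) (fun _ _ => sq_nonneg _) (Finset.mem_univ i)

lemma abs_wave_le_sqrt_eigen (L : ℝ) (k : Fin 3 → ℤ) (i : Fin 3) :
    |wave L k i| ≤ eigen L k ^ (1 / 2 : ℝ) := by
  rw [← Real.sqrt_eq_rpow]
  exact Real.abs_le_sqrt (wave_sq_le_eigen L k i)

/-- The spectral gap of the Stokes operator. -/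
lemma le_eigen (L : ℝ) {k : Fin 3 → ℤ} (hk : k ≠ 0) : (2 * Real.pi / L) ^ 2 ≤ eigen L k := by
  obtain ⟨i, hi⟩ := Function.ne_iff.mp hk
  refine le_trans ?_ (wave_sq_le_eigen L k i)
  have h1 : (1 : ℝ) ≤ (k i : ℝ) ^ 2 := by
    have hi' : k i ≠ 0 := hi
    have : 0 < (k i) ^ 2 := by positivity
    exact_mod_cast this
  have : wave L k i ^ 2 = (2 * Real.pi / L) ^ 2 * (k i : ℝ) ^ 2 := by
    rw [wave]; ring
  rw [this]
  exact le_mul_of_one_le_right (sq_nonneg _) h1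

lemma eigen_pos {k : Fin 3 → ℤ} (hk : k ≠ 0) : 0 < eigen L k := by
  have : 0 < L := Fact.out
  exact lt_of_lt_of_le (by positivity) (le_eigen L hk)

lemma coef_stokesPow {s : ℝ} {u : VecField L} (h : u ∈ stokesDom L s) (j : Fin 3)
    (k : Fin 3 → ℤ) :
    coef (stokesPow s u) j k = ((eigen L k ^ s : ℝ) : ℂ) * coef u j k := by
  have h' : ∃ w, IsStokesPow s u w := h
  rw [stokesPow, dif_pos h']
  exact h'.choose_spec.2.2 k j

lemma mem_H_of_mem_stokesDom {s : ℝ} {u : VecField L} (h : u ∈ stokesDom L s) : u ∈ H L := by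
  obtain ⟨w, hw⟩ := h
  exact hw.1

lemma coef_weakPartial {i : Fin 3} {u : VecField L} (h : ∃ w, IsWeakPartial i u w) (j : Fin 3)
    (k : Fin 3 → ℤ) :
    coef (weakPartial i u) j k = Complex.I * ((wave L k i : ℝ) : ℂ) * coef u j k := by
  rw [weakPartial, dif_pos h]
  exact h.choose_spec k j

/-- A Fourier multiplier maps `u` to `L²` as soon as the result is dominated by an `L²` field. -/
lemma exists_multiplier (m : (Fin 3 → ℤ) → ℂ) (hm : ∀ k, m (-k) = conj (m k))
    (u w : VecField L) (C : ℝ) (hb : ∀ j k, ‖m k * coef u j k‖ ≤ C * ‖coef w j k‖) :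
    ∃ v : VecField L, ∀ j k, coef v j k = m k * coef u j k := by
  refine exists_of_coef (fun j k => m k * coef u j k) (fun j k => ?_) fun j => ?_
  · rw [hm, coef_neg, map_mul]
  · have h1 : Summable fun k => ‖coef w j k‖ ^ 2 :=
      (summable_sum_coef_sq w).of_nonneg_of_le (fun k => sq_nonneg _) fun k =>
        Finset.single_le_sum (f := fun j => ‖coef w j k‖ ^ 2) (fun _ _ => sq_nonneg _)
          (Finset.mem_univ j)
    refine (h1.mul_left (C ^ 2)).of_nonneg_of_le (fun k => sq_nonneg _) fun k => ?_
    rw [← mul_pow]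
    exact pow_le_pow_left₀ (norm_nonneg _) (hb j k) 2

/-- A multiplier that acts alike on all three components commutes with the divergence. -/
lemma mem_H_of_multiplier {u v : VecField L} {m : (Fin 3 → ℤ) → ℂ} (hu : u ∈ H L)
    (h : ∀ j k, coef v j k = m k * coef u j k) : v ∈ H L := by
  refine ⟨fun j => ?_, fun k => ?_⟩
  · rw [h, hu.1, mul_zero]
  · simp only [h, mul_left_comm _ (m k)]
    rw [← Finset.mul_sum, hu.2, mul_zero]

/-- The criterion by which domain membership is checked below: comparison with a known `L²` field,
then Riesz–Fischer. -/
lemma mem_stokesDom_of_bound {s : ℝ} {u : VecField L} (hu : u ∈ H L) (w : VecField L) (C : ℝ)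
    (hb : ∀ j k, eigen L k ^ s * ‖coef u j k‖ ≤ C * ‖coef w j k‖) : u ∈ stokesDom L s := by
  obtain ⟨v, hv⟩ := exists_multiplier (fun k => ((eigen L k ^ s : ℝ) : ℂ))
    (fun k => by rw [eigen_neg, Complex.conj_ofReal]) u w C (fun j k => by
      rw [norm_mul, Complex.norm_real, Real.norm_of_nonneg (Real.rpow_nonneg (eigen_nonneg L k) _)]
      exact hb j k)
  exact ⟨v, hu, mem_H_of_multiplier hu hv, fun k j => hv j k⟩

lemma stokesPow_mem_H {s : ℝ} {u : VecField L} (h : u ∈ stokesDom L s) : stokesPow s u ∈ H L :=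
  mem_H_of_multiplier (mem_H_of_mem_stokesDom h) (coef_stokesPow h)

/-- Negative powers of the Stokes operator are defined on all of `H`. -/
lemma mem_stokesDom_of_nonpos {s : ℝ} (hs : s ≤ 0) {u : VecField L} (hu : u ∈ H L) :
    u ∈ stokesDom L s := by
  have hL : 0 < L := Fact.out
  refine mem_stokesDom_of_bound hu u (((2 * Real.pi / L) ^ 2) ^ s) fun j k => ?_
  by_cases hk : k = 0
  · simp [hk, hu.1]
  · exact mul_le_mul_of_nonneg_right
      (Real.rpow_le_rpow_of_nonpos (by positivity) (le_eigen L hk) hs) (norm_nonneg _)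

lemma exists_weakPartial_of_bound {u : VecField L} (i : Fin 3) (w : VecField L)
    (hb : ∀ j k, eigen L k ^ (1 / 2 : ℝ) * ‖coef u j k‖ ≤ ‖coef w j k‖) :
    ∃ v, IsWeakPartial i u v := by
  obtain ⟨v, hv⟩ := exists_multiplier (fun k => Complex.I * ((wave L k i : ℝ) : ℂ))
    (fun k => by simp [wave_neg]) u w 1 (fun j k => by
      rw [norm_mul, norm_mul, Complex.norm_I, one_mul, Complex.norm_real, Real.norm_eq_abs, one_mul]
      exact (mul_le_mul_of_nonneg_right (abs_wave_le_sqrt_eigen L k i) (norm_nonneg _)).trans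
        (hb j k))
  exact ⟨v, fun k j => hv j k⟩

lemma norm_coef_stokesPow {s : ℝ} {u : VecField L} (h : u ∈ stokesDom L s) (j : Fin 3)
    (k : Fin 3 → ℤ) : ‖coef (stokesPow s u) j k‖ = eigen L k ^ s * ‖coef u j k‖ := by
  rw [coef_stokesPow h, norm_mul, Complex.norm_real,
    Real.norm_of_nonneg (Real.rpow_nonneg (eigen_nonneg L k) _)]

lemma exists_weakPartial {u : VecField L} (h : u ∈ V L) (i : Fin 3) :
    ∃ v, IsWeakPartial i u v :=
  exists_weakPartial_of_bound i (stokesPow (1 / 2) u) fun j k => (norm_coef_stokesPow h j k).ge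

/-- The squared norm of a sum over the three partial derivatives. -/
lemma hasSum_sum_norm_sq {p : Fin 3 → VecField L} {u : VecField L} {m : (Fin 3 → ℤ) → ℝ}
    (h : ∀ i j k, ‖coef (p i) j k‖ = m k * (|wave L k i| * ‖coef u j k‖)) :
    HasSum (fun k => L ^ 3 * ∑ j, m k ^ 2 * eigen L k * ‖coef u j k‖ ^ 2) (∑ i, ‖p i‖ ^ 2) := by
  refine (hasSum_sum fun i _ => hasSum_norm_sq (p i)).congr_fun fun k => ?_
  rw [← Finset.mul_sum Finset.univ (fun i => ∑ j, ‖coef (p i) j k‖ ^ 2) (L ^ 3)]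
  congr 1
  rw [Finset.sum_comm]
  refine Finset.sum_congr rfl fun j _ => ?_
  simp only [h, mul_pow, sq_abs, eigen]
  rw [Finset.mul_sum, Finset.sum_mul]
  exact Finset.sum_congr rfl fun i _ => by ring

lemma norm_coef_weakPartial {u : VecField L} {i : Fin 3} (h : ∃ w, IsWeakPartial i u w)
    (j : Fin 3) (k : Fin 3 → ℤ) :
    ‖coef (weakPartial i u) j k‖ = |wave L k i| * ‖coef u j k‖ := by
  rw [coef_weakPartial h, norm_mul, norm_mul, Complex.norm_I, one_mul, Complex.norm_real,
    Real.norm_eq_abs]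

/-- **Poincaré's inequality** on `V`. -/
lemma poincare {u : VecField L} (h : u ∈ V L) :
    (2 * Real.pi / L) ^ 2 * ‖u‖ ^ 2 ≤ gradSq u := by
  have hL : 0 < L := Fact.out
  have h1 := hasSum_sum_norm_sq (p := fun i => weakPartial i u) (u := u) (m := fun _ => 1)
    (fun i j k => by rw [norm_coef_weakPartial (exists_weakPartial h i), one_mul])
  refine hasSum_le (fun k => ?_) ((hasSum_norm_sq u).mul_left _) h1
  rw [mul_left_comm, Finset.mul_sum]
  refine mul_le_mul_of_nonneg_left (Finset.sum_le_sum fun j _ => ?_) (by positivity)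
  by_cases hk : k = 0
  · simp [hk, (mem_H_of_mem_stokesDom h).1]
  · rw [one_pow, one_mul]
    exact mul_le_mul_of_nonneg_right (le_eigen L hk) (sq_nonneg _)

lemma gradSq_nonneg (u : VecField L) : 0 ≤ gradSq u := Finset.sum_nonneg fun _ _ => sq_nonneg _

lemma inner_eq_of_coef {u v u' v' : VecField L}
    (h : ∀ j k, conj (coef u j k) * coef v j k = conj (coef u' j k) * coef v' j k) :
    inner ℝ u v = inner ℝ u' v' := by
  refine (hasSum_inner u v).unique ?_
  simpa only [h] using hasSum_inner u' v'

variable {f : VecField L}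

lemma coef_inv_half (hf : f ∈ H L) (j : Fin 3) (k : Fin 3 → ℤ) :
    eigen L k ^ (1 / 2 : ℝ) * ‖coef (stokesPow (-1) f) j k‖
      = ‖coef (stokesPow (-(1 / 2)) f) j k‖ := by
  rw [norm_coef_stokesPow (mem_stokesDom_of_nonpos (by norm_num) hf),
    norm_coef_stokesPow (mem_stokesDom_of_nonpos (by norm_num) hf), ← mul_assoc]
  by_cases hk : k = 0
  · simp [hk, hf.1]
  · rw [← Real.rpow_add (eigen_pos hk)]
    norm_num

/-- Makes `A⁻¹f` an admissible test function in the weak formulation. -/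
lemma stokesPow_neg_one_mem_V (hf : f ∈ H L) : stokesPow (-1) f ∈ V L :=
  mem_stokesDom_of_bound (stokesPow_mem_H (mem_stokesDom_of_nonpos (by norm_num) hf))
    (stokesPow (-(1 / 2)) f) 1 fun j k => by rw [one_mul, coef_inv_half hf]

/-- `(A^{1/2}u, A^{1/2}A^{-1}f) = (f, u)`. -/
lemma inner_half_half_neg_one (hf : f ∈ H L) {u : VecField L} (hu : u ∈ V L) :
    inner ℝ (stokesPow (1 / 2) u) (stokesPow (1 / 2) (stokesPow (-1) f)) = inner ℝ u f := by
  refine inner_eq_of_coef fun j k => ?_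
  rw [coef_stokesPow hu, coef_stokesPow (stokesPow_neg_one_mem_V hf),
    coef_stokesPow (mem_stokesDom_of_nonpos (by norm_num) hf), map_mul, Complex.conj_ofReal]
  by_cases hk : k = 0
  · simp [hk, hf.1]
  · have h0 := eigen_pos (L := L) hk
    have : eigen L k ^ (1 / 2 : ℝ) * (eigen L k ^ (1 / 2 : ℝ) * eigen L k ^ (-1 : ℝ)) = 1 := by
      rw [← Real.rpow_add h0, ← Real.rpow_add h0]
      norm_num
    have h1 : ((eigen L k ^ (1 / 2 : ℝ) : ℝ) : ℂ) * (((eigen L k ^ (1 / 2 : ℝ) : ℝ) : ℂ)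
      * ((eigen L k ^ (-1 : ℝ) : ℝ) : ℂ)) = 1 := by exact_mod_cast this
    linear_combination (conj (coef u j k) * coef f j k) * h1

/-- `(f, A^{-1}f) = ‖A^{-1/2}f‖²`. -/
lemma inner_stokesPow_neg_one (hf : f ∈ H L) :
    inner ℝ f (stokesPow (-1) f) = ‖stokesPow (-(1 / 2)) f‖ ^ 2 := by
  rw [← real_inner_self_eq_norm_sq]
  refine inner_eq_of_coef fun j k => ?_
  rw [coef_stokesPow (mem_stokesDom_of_nonpos (by norm_num) hf),
    coef_stokesPow (mem_stokesDom_of_nonpos (by norm_num) hf), map_mul, Complex.conj_ofReal]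
  by_cases hk : k = 0
  · simp [hk, hf.1]
  · have h0 := eigen_pos (L := L) hk
    have : eigen L k ^ (-(1 / 2) : ℝ) * eigen L k ^ (-(1 / 2) : ℝ) = eigen L k ^ (-1 : ℝ) := by
      rw [← Real.rpow_add h0]
      norm_num
    rw [← this]
    push_cast
    ring

/-- `A^s f ≠ 0` for `f ≠ 0`. -/
lemma stokesPow_ne_zero {s : ℝ} (hf : f ∈ stokesDom L s) (h0 : f ≠ 0) : stokesPow s f ≠ 0 := by
  intro h
  apply h0
  refine coef_ext fun j k => ?_
  have h1 := coef_stokesPow hf j k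
  have hz : ∀ j k, coef (0 : VecField L) j k = 0 := by
    intro j k
    have := hasSum_norm_sq (0 : VecField L)
    rw [norm_zero, zero_pow two_ne_zero, hasSum_zero_iff_of_nonneg] at this
    · have h2 := congrFun this k
      have hL : (L ^ 3 : ℝ) ≠ 0 := pow_ne_zero _ (Fact.out : 0 < L).ne'
      rw [Pi.zero_apply, mul_eq_zero, or_iff_right hL,
        Finset.sum_eq_zero_iff_of_nonneg fun _ _ => sq_nonneg _] at h2
      simpa using h2 j (Finset.mem_univ j)
    · intro k
      have hL : 0 < L := Fact.out
      exact mul_nonneg (by positivity) (Finset.sum_nonneg fun _ _ => sq_nonneg _)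
  rw [hz]
  by_cases hk : k = 0
  · rw [hk]; exact (mem_H_of_mem_stokesDom hf).1 j
  · rw [h, hz, eq_comm, mul_eq_zero] at h1
    refine h1.resolve_left ?_
    exact_mod_cast (Real.rpow_pos_of_pos (eigen_pos hk) s).ne'

/-- Agmon's inequality bounds the gradient of `A^{-1}f`. -/
lemma ae_sum_weakPartial_sq_le {C : ℝ} (hC : AgmonInequality L C)
    (hf : f ∈ stokesDom L (1 / 2)) :
    ∀ᵐ x : Torus L, ∑ i, ‖weakPartial i (stokesPow (-1) f) x‖ ^ 2
      ≤ C ^ 2 * (‖f‖ * ‖stokesPow (1 / 2) f‖) := by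
  have hfH := mem_H_of_mem_stokesDom hf
  have hd := mem_stokesDom_of_nonpos (s := -1) (by norm_num) hfH
  set p : Fin 3 → VecField L := fun i => weakPartial i (stokesPow (-1) f) with hp
  have hex := exists_weakPartial (stokesPow_neg_one_mem_V hfH)
  have hn : ∀ i j k, ‖coef (p i) j k‖ = |wave L k i| * (eigen L k ^ (-1 : ℝ) * ‖coef f j k‖) := by
    intro i j k
    rw [hp, norm_coef_weakPartial (hex i), norm_coef_stokesPow hd]
  have hpH : ∀ i, p i ∈ H L := fun i => mem_H_of_multiplier
    (stokesPow_mem_H hd) (coef_weakPartial (hex i))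
  -- `A ∂ᵢ A⁻¹f` is formally `∂ᵢ f`, which is in `L²` because `f ∈ D(A^{1/2})`; this is where that
  -- regularity is needed.
  have hp1 : ∀ i, p i ∈ stokesDom L 1 := by
    intro i
    refine mem_stokesDom_of_bound (hpH i) (stokesPow (1 / 2) f) 1 fun j k => ?_
    rw [hn, norm_coef_stokesPow hf, one_mul]
    by_cases hk : k = 0
    · simp [hk, hfH.1]
    · have h0 := eigen_pos (L := L) hk
      rw [Real.rpow_one, Real.rpow_neg_one]
      calc eigen L k * (|wave L k i| * ((eigen L k)⁻¹ * ‖coef f j k‖))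
          = |wave L k i| * ‖coef f j k‖ := by field_simp
        _ ≤ _ := mul_le_mul_of_nonneg_right (abs_wave_le_sqrt_eigen L k i) (norm_nonneg _)
  have hph : ∀ i, p i ∈ stokesDom L (1 / 2) := by
    intro i
    refine mem_stokesDom_of_bound (hpH i) f 1 fun j k => ?_
    rw [hn, one_mul]
    by_cases hk : k = 0
    · simp [hk, hfH.1]
    · have h0 := eigen_pos (L := L) hk
      calc eigen L k ^ (1 / 2 : ℝ) * (|wave L k i| * (eigen L k ^ (-1 : ℝ) * ‖coef f j k‖))
          ≤ eigen L k ^ (1 / 2 : ℝ) * (eigen L k ^ (1 / 2 : ℝ)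
              * (eigen L k ^ (-1 : ℝ) * ‖coef f j k‖)) := by
            have := abs_wave_le_sqrt_eigen L k i
            gcongr
        _ = (eigen L k ^ (1 / 2 : ℝ) * eigen L k ^ (1 / 2 : ℝ)
              * eigen L k ^ (-1 : ℝ)) * ‖coef f j k‖ := by ring
        _ ≤ _ := by
          rw [← Real.rpow_add h0, ← Real.rpow_add h0]
          norm_num
  -- Summing over `i` turns the factors `|wave|²` into one eigenvalue, so this bound and the next
  -- are in fact equalities.
  have hs1 : ∑ i, ‖stokesPow (1 / 2) (p i)‖ ^ 2 ≤ ‖f‖ ^ 2 := by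
    have h1 := hasSum_sum_norm_sq (p := fun i => stokesPow (1 / 2) (p i)) (u := f)
      (m := fun k => eigen L k ^ (1 / 2 : ℝ) * eigen L k ^ (-1 : ℝ))
      (fun i j k => by rw [norm_coef_stokesPow (hph i), hn]; ring)
    refine (h1.unique ((hasSum_norm_sq f).congr_fun fun k => ?_)).le
    congr 1
    refine Finset.sum_congr rfl fun j _ => ?_
    by_cases hk : k = 0
    · simp [hk, hfH.1]
    · have h0 := eigen_pos (L := L) hk
      have : (eigen L k ^ (1 / 2 : ℝ) * eigen L k ^ (-1 : ℝ)) ^ 2 * eigen L k = 1 := by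
        rw [← Real.sqrt_eq_rpow, mul_pow, Real.sq_sqrt h0.le, Real.rpow_neg_one]
        field_simp
      rw [this, one_mul]
  have hs2 : ∑ i, ‖stokesPow 1 (p i)‖ ^ 2 ≤ ‖stokesPow (1 / 2) f‖ ^ 2 := by
    have h1 := hasSum_sum_norm_sq (p := fun i => stokesPow 1 (p i)) (u := f)
      (m := fun k => eigen L k ^ (1 : ℝ) * eigen L k ^ (-1 : ℝ))
      (fun i j k => by rw [norm_coef_stokesPow (hp1 i), hn]; ring)
    refine (h1.unique ((hasSum_norm_sq _).congr_fun fun k => ?_)).le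
    congr 1
    refine Finset.sum_congr rfl fun j _ => ?_
    rw [norm_coef_stokesPow hf]
    by_cases hk : k = 0
    · simp [hk, hfH.1]
    · have h0 := eigen_pos (L := L) hk
      rw [← Real.sqrt_eq_rpow, mul_pow (√_), Real.sq_sqrt h0.le, Real.rpow_neg_one, Real.rpow_one]
      field_simp
  filter_upwards [ae_all_iff.2 fun i => hC (p i) (hp1 i)] with x hx
  have hsq : ∀ i, ‖p i x‖ ^ 2 ≤ C ^ 2 * (‖stokesPow (1 / 2) (p i)‖ * ‖stokesPow 1 (p i)‖) := by
    intro i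
    refine (pow_le_pow_left₀ (norm_nonneg _) (hx i) 2).trans_eq ?_
    rw [← Real.sqrt_eq_rpow, ← Real.sqrt_eq_rpow, mul_pow, mul_pow, Real.sq_sqrt (norm_nonneg _),
      Real.sq_sqrt (norm_nonneg _), mul_assoc]
  calc ∑ i, ‖p i x‖ ^ 2
      ≤ ∑ i, C ^ 2 * (‖stokesPow (1 / 2) (p i)‖ * ‖stokesPow 1 (p i)‖) :=
        Finset.sum_le_sum fun i _ => hsq i
    _ = C ^ 2 * ∑ i, ‖stokesPow (1 / 2) (p i)‖ * ‖stokesPow 1 (p i)‖ := by rw [Finset.mul_sum]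
    _ ≤ C ^ 2 * (‖f‖ * ‖stokesPow (1 / 2) f‖) := by
        refine mul_le_mul_of_nonneg_left ?_ (sq_nonneg _)
        -- Cauchy–Schwarz over the three directions keeps Agmon's constant exactly `C`, with no
        -- dimensional factor.
        have hcs := Finset.sum_mul_sq_le_sq_mul_sq Finset.univ
          (fun i => ‖stokesPow (1 / 2) (p i)‖) (fun i => ‖stokesPow 1 (p i)‖)
        refine le_of_sq_le_sq (hcs.trans ?_) (by positivity)
        rw [mul_pow]
        exact mul_le_mul hs1 hs2 (Finset.sum_nonneg fun _ _ => sq_nonneg _) (sq_nonneg _)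

lemma integral_norm_sq (u : VecField L) : ∫ x : Torus L, ‖u x‖ ^ 2 = ‖u‖ ^ 2 := by
  rw [← real_inner_self_eq_norm_sq, MeasureTheory.L2.inner_def]
  simp only [real_inner_self_eq_norm_sq]

/-- The nonlinear term tested against `A^{-1}f`. -/
lemma abs_trilinear_le {C : ℝ} (hC0 : 0 ≤ C) (hC : AgmonInequality L C)
    (hf : f ∈ stokesDom L (1 / 2)) (u : VecField L) :
    |trilinear u (stokesPow (-1) f) u|
      ≤ C * (‖f‖ ^ (1 / 2 : ℝ) * ‖stokesPow (1 / 2) f‖ ^ (1 / 2 : ℝ)) * ‖u‖ ^ 2 := by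
  rw [← integral_norm_sq, ← integral_const_mul, trilinear, ← Real.norm_eq_abs]
  refine norm_integral_le_of_norm_le ?_ ?_
  · exact ((Lp.memLp u).integrable_norm_pow two_ne_zero).const_mul _
  filter_upwards [ae_sum_weakPartial_sq_le hC hf] with x hx
  refine (norm_inner_le_norm _ _).trans ?_
  rw [sq, ← mul_assoc]
  refine mul_le_mul_of_nonneg_right ?_ (norm_nonneg _)
  refine (norm_sum_le _ _).trans ?_
  simp only [norm_smul, Real.norm_eq_abs]
  refine le_of_sq_le_sq ?_ (by positivity)
  refine (Finset.sum_mul_sq_le_sq_mul_sq _ _ _).trans ?_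
  rw [mul_pow, mul_pow, mul_pow, ← Real.sqrt_eq_rpow, ← Real.sqrt_eq_rpow,
    Real.sq_sqrt (norm_nonneg _), Real.sq_sqrt (norm_nonneg _), mul_comm, EuclideanSpace.norm_sq_eq]
  simp only [Real.norm_eq_abs]
  exact mul_le_mul_of_nonneg_right hx (Finset.sum_nonneg fun _ _ => sq_nonneg _)

end Stokes

/-! ### Agmon's inequality with a constant independent of the box. -/

section Agmon

variable {L : ℝ} [Fact (0 < L)]

/-- The squared length of a lattice vector. -/
def latticeSq (k : Fin 3 → ℤ) : ℝ := ∑ i, (k i : ℝ) ^ 2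

lemma latticeSq_nonneg (k : Fin 3 → ℤ) : 0 ≤ latticeSq k :=
  Finset.sum_nonneg fun _ _ => sq_nonneg _

lemma eigen_eq (L : ℝ) (k : Fin 3 → ℤ) : eigen L k = (2 * Real.pi / L) ^ 2 * latticeSq k := by
  rw [eigen, latticeSq, Finset.mul_sum]
  exact Finset.sum_congr rfl fun i _ => by rw [wave]; ring

/-- The shell is a difference of cubes, `(2n+3)³ - (2n+1)³ = 24n² + 48n + 26`. -/
lemma card_box_le (n : ℕ) :
    ((Finset.box (n + 1) : Finset (Fin 3 → ℤ)).card : ℝ) ≤ 26 * ((n : ℝ) + 1) ^ 2 := by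
  have h : ∀ m : ℕ, (Finset.Icc (-(m : Fin 3 → ℤ)) (m : Fin 3 → ℤ)).card = (2 * m + 1) ^ 3 := by
    intro m
    rw [Pi.card_Icc]
    have : ∀ i : Fin 3, (Finset.Icc ((-(m : Fin 3 → ℤ)) i) ((m : Fin 3 → ℤ) i)).card
        = 2 * m + 1 := by
      intro i
      rw [Int.card_Icc]
      simp only [Pi.neg_apply, Pi.natCast_apply]
      omega
    rw [Finset.prod_congr rfl fun i _ => this i]
    simp
  rw [Finset.box_succ_eq_sdiff, Finset.card_sdiff_of_subset, h, h]
  swap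
  · have : (n : Fin 3 → ℤ) ≤ (n.succ : Fin 3 → ℤ) := Nat.mono_cast n.le_succ
    exact Finset.Icc_subset_Icc (neg_le_neg this) this
  have h2 : (2 * (n + 1) + 1) ^ 3 - (2 * n + 1) ^ 3 ≤ 26 * (n + 1) ^ 2 := by
    rw [Nat.sub_le_iff_le_add]
    have : (2 * (n + 1) + 1) ^ 3 + (2 * n ^ 2 + 4 * n) = 26 * (n + 1) ^ 2 + (2 * n + 1) ^ 3 := by
      ring
    omega
  exact_mod_cast h2

/-- The shell index is the side parameter of the smallest centred cube containing `k`. -/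
lemma exists_mem_box (k : Fin 3 → ℤ) : ∃ n : ℕ, k ∈ (Finset.box n : Finset (Fin 3 → ℤ)) := by
  have h : ∃ n : ℕ, k ∈ Finset.Icc (-(n : Fin 3 → ℤ)) n := by
    refine ⟨∑ i, (k i).natAbs, ?_⟩
    have h : ∀ i, |k i| ≤ ((∑ i, (k i).natAbs : ℕ) : ℤ) := fun i => by
      rw [Int.abs_eq_natAbs]
      exact_mod_cast Finset.single_le_sum (f := fun i => (k i).natAbs)
        (fun _ _ => Nat.zero_le _) (Finset.mem_univ i)
    rw [Finset.mem_Icc]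
    exact ⟨fun i => (abs_le.1 (h i)).1, fun i => (abs_le.1 (h i)).2⟩
  classical
  rcases hn : Nat.find h with _ | n
  · refine ⟨0, ?_⟩
    have := Nat.find_spec h
    rw [hn] at this
    simpa using this
  · refine ⟨n + 1, ?_⟩
    rw [Finset.box_succ_eq_sdiff, Finset.mem_sdiff]
    refine ⟨?_, Nat.find_min h (by omega)⟩
    have := Nat.find_spec h
    rwa [hn] at this

lemma sq_le_latticeSq {n : ℕ} {k : Fin 3 → ℤ} (hk : k ∈ (Finset.box (n + 1) : Finset _)) :
    ((n : ℝ) + 1) ^ 2 ≤ latticeSq k := by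
  rw [Finset.box_succ_eq_sdiff, Finset.mem_sdiff] at hk
  have h : ∃ i, (n : ℤ) + 1 ≤ |k i| := by
    by_contra! hcon
    apply hk.2
    rw [Finset.mem_Icc]
    constructor <;> intro i <;> have := hcon i <;> rw [Int.lt_add_one_iff, abs_le] at this
    · simpa using this.1
    · simpa using this.2
  obtain ⟨i, hi⟩ := h
  refine le_trans ?_ (Finset.single_le_sum (f := fun i => (k i : ℝ) ^ 2)
    (fun _ _ => sq_nonneg _) (Finset.mem_univ i))
  rw [← sq_abs (k i : ℝ)]
  have : ((n : ℝ) + 1) ≤ |(k i : ℝ)| := by exact_mod_cast hi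
  gcongr

/-- Telescoping: `(N+n)(N+n+1) ≤ 2(N² + (n+1)²)` dominates each term by a difference of consecutive
values of `2N²/(N+n)`. -/
lemma sum_range_inv_one_add_sq_le {N : ℝ} (hN : 0 < N) (R : ℕ) :
    ∑ n ∈ Finset.range R, 1 / (1 + ((n : ℝ) + 1) ^ 2 / N ^ 2) ≤ 2 * N := by
  have h : ∀ n : ℕ, 1 / (1 + ((n : ℝ) + 1) ^ 2 / N ^ 2)
      ≤ 2 * N ^ 2 / (N + n) - 2 * N ^ 2 / (N + (n + 1 : ℕ)) := by
    intro n
    have hn : (0 : ℝ) ≤ n := n.cast_nonneg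
    have e : 2 * N ^ 2 / (N + n) - 2 * N ^ 2 / (N + (n + 1 : ℕ))
        = 2 * N ^ 2 / ((N + n) * (N + n + 1)) := by
      push_cast
      field_simp
      ring
    have e' : 1 / (1 + ((n : ℝ) + 1) ^ 2 / N ^ 2) = N ^ 2 / (N ^ 2 + ((n : ℝ) + 1) ^ 2) := by
      field_simp
    rw [e, e', div_le_div_iff₀ (by positivity) (by positivity)]
    have : (N + n) * (N + n + 1) ≤ 2 * (N ^ 2 + ((n : ℝ) + 1) ^ 2) := by
      nlinarith [sq_nonneg (N - (n + 1))]
    nlinarith [sq_nonneg N]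
  refine (Finset.sum_le_sum fun n _ => h n).trans ?_
  rw [Finset.sum_range_sub' (fun n : ℕ => 2 * N ^ 2 / (N + n))]
  have h1 : (0 : ℝ) ≤ 2 * N ^ 2 / (N + R) := by positivity
  have h2 : 2 * N ^ 2 / (N + (0 : ℕ)) = 2 * N := by
    push_cast; field_simp; ring
  linarith

/-- Sum over sup-norm shells: the quadratic growth of a shell cancels the factor `1/|k|²`, leaving
the one-dimensional sum. The constant is `26 · 2`; the origin contributes `1 / 0 = 0`. -/
lemma sum_lattice_le {N : ℝ} (hN : 0 < N) (s : Finset (Fin 3 → ℤ)) :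
    ∑ k ∈ s, 1 / (latticeSq k * (1 + latticeSq k / N ^ 2)) ≤ 52 * N := by
  choose n hn using exists_mem_box
  set g : (Fin 3 → ℤ) → ℝ := fun k => 1 / (latticeSq k * (1 + latticeSq k / N ^ 2)) with hg
  have hmaps : ∀ k ∈ s, n k ∈ Finset.range (s.sup n + 1) := fun k hk =>
    Finset.mem_range.2 (Nat.lt_succ_of_le (Finset.le_sup hk))
  rw [← Finset.sum_fiberwise_of_maps_to hmaps, Finset.sum_range_succ']
  have h0 : ∑ k ∈ s with n k = 0, g k = 0 := by
    refine Finset.sum_eq_zero fun k hk => ?_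
    have h := hn k
    rw [(Finset.mem_filter.1 hk).2] at h
    have : k = 0 := by simpa using h
    simp [hg, this, latticeSq]
  rw [h0, add_zero]
  have h1 : ∀ m : ℕ, ∑ k ∈ s with n k = m + 1, g k
      ≤ 26 * (1 / (1 + ((m : ℝ) + 1) ^ 2 / N ^ 2)) := by
    intro m
    have hb : ∀ k ∈ s.filter (fun k => n k = m + 1),
        g k ≤ 1 / (((m : ℝ) + 1) ^ 2 * (1 + ((m : ℝ) + 1) ^ 2 / N ^ 2)) := by
      intro k hk
      have h := hn k
      rw [(Finset.mem_filter.1 hk).2] at h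
      have h2 := sq_le_latticeSq h
      rw [hg]
      dsimp only
      have := latticeSq_nonneg k
      gcongr
    have hc : ((s.filter (fun k => n k = m + 1)).card : ℝ) ≤ 26 * ((m : ℝ) + 1) ^ 2 := by
      refine le_trans ?_ (card_box_le m)
      have : s.filter (fun k => n k = m + 1) ⊆ Finset.box (m + 1) := by
        intro k hk
        have h := hn k
        rwa [(Finset.mem_filter.1 hk).2] at h
      exact_mod_cast Finset.card_le_card this
    refine (Finset.sum_le_card_nsmul _ _ _ hb).trans ?_
    rw [nsmul_eq_mul]
    refine (mul_le_mul_of_nonneg_right hc (by positivity)).trans_eq ?_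
    field_simp
  refine (Finset.sum_le_sum fun m _ => h1 m).trans ?_
  rw [← Finset.mul_sum]
  have := sum_range_inv_one_add_sq_le hN (s.sup n)
  linarith

lemma stokesDom_one_subset_half {w : VecField L} (hw : w ∈ stokesDom L 1) :
    w ∈ stokesDom L (1 / 2) := by
  have hL : 0 < L := Fact.out
  refine mem_stokesDom_of_bound (mem_H_of_mem_stokesDom hw) (stokesPow 1 w)
    (((2 * Real.pi / L) ^ 2) ^ (-(1 / 2) : ℝ)) fun j k => ?_
  rw [norm_coef_stokesPow hw, ← mul_assoc]
  by_cases hk : k = 0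
  · simp [hk, (mem_H_of_mem_stokesDom hw).1]
  · have h0 := eigen_pos (L := L) hk
    refine mul_le_mul_of_nonneg_right ?_ (norm_nonneg _)
    have h1 : eigen L k ^ (-(1 / 2) : ℝ) ≤ ((2 * Real.pi / L) ^ 2) ^ (-(1 / 2) : ℝ) :=
      Real.rpow_le_rpow_of_nonpos (by positivity) (le_eigen L hk) (by norm_num)
    calc eigen L k ^ (1 / 2 : ℝ) = eigen L k ^ (-(1 / 2) : ℝ) * eigen L k ^ (1 : ℝ) := by
          rw [← Real.rpow_add h0]; norm_num
      _ ≤ _ := mul_le_mul_of_nonneg_right h1 (Real.rpow_nonneg h0.le _)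

/-- Cauchy–Schwarz with weight `λ(1 + λX²/Y²)`, where `λ` is the eigenvalue. The two parts of the
weighted sum then both contribute at most `X²`, and the reciprocal weights form the preceding
lattice sum. -/
lemma sum_norm_coef_le {w : VecField L} (hw : w ∈ stokesDom L 1) (h0 : w ≠ 0) (j : Fin 3)
    (s : Finset (Fin 3 → ℤ)) :
    ∑ k ∈ s, ‖coef w j k‖
      ≤ 11 * (‖stokesPow (1 / 2) w‖ ^ (1 / 2 : ℝ) * ‖stokesPow 1 w‖ ^ (1 / 2 : ℝ)) := by
  have hL : 0 < L := Fact.out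
  have hh := stokesDom_one_subset_half hw
  set X := ‖stokesPow (1 / 2) w‖ with hX
  set Y := ‖stokesPow 1 w‖ with hY
  have hX0 : 0 < X := norm_pos_iff.2 (stokesPow_ne_zero hh h0)
  have hY0 : 0 < Y := norm_pos_iff.2 (stokesPow_ne_zero hw h0)
  have hpi : 1 ≤ 2 * Real.pi := by linarith [Real.pi_gt_three]
  -- The crossover frequency: with this choice `λX²/Y² = |k|²/N²`. All powers of `L` cancel in the
  -- final product.
  set N : ℝ := Y * L / (2 * Real.pi * X) with hN
  have hN0 : 0 < N := by positivity
  set q : (Fin 3 → ℤ) → ℝ :=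
    fun k => eigen L k * (1 + eigen L k * (X ^ 2 / Y ^ 2)) * ‖coef w j k‖ ^ 2
  set g : (Fin 3 → ℤ) → ℝ :=
    fun k => (L / (2 * Real.pi)) ^ 2 * (1 / (latticeSq k * (1 + latticeSq k / N ^ 2)))
  have hgq : ∀ k ∈ s, ‖coef w j k‖ ^ 2 = g k * q k := by
    intro k _
    by_cases hk : k = 0
    · simp [g, q, hk, (mem_H_of_mem_stokesDom hw).1]
    · have he := eigen_pos (L := L) hk
      have hl : 0 < latticeSq k := by
        rw [eigen_eq] at he
        exact pos_of_mul_pos_right he (sq_nonneg _)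
      simp only [g, q, eigen_eq, hN]
      field_simp
  have hg0 : ∀ k ∈ s, 0 ≤ g k := fun k _ => by
    have := latticeSq_nonneg k
    positivity
  have hq0 : ∀ k, 0 ≤ q k := fun k => by
    have := eigen_nonneg L k
    positivity
  have hcs := Finset.sum_sq_le_sum_mul_sum_of_sq_le_mul s hg0 (fun k _ => hq0 k)
    fun k hk => (hgq k hk).le
  have hgs : ∑ k ∈ s, g k ≤ (L / (2 * Real.pi)) ^ 2 * (52 * N) := by
    rw [← Finset.mul_sum]
    exact mul_le_mul_of_nonneg_left (sum_lattice_le hN0 s) (sq_nonneg _)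
  have hqs : L ^ 3 * ∑ k ∈ s, q k ≤ 2 * X ^ 2 := by
    have h1 := (hasSum_norm_sq (stokesPow (1 / 2) w)).add
      ((hasSum_norm_sq (stokesPow 1 w)).mul_left (X ^ 2 / Y ^ 2))
    have h2 : ‖stokesPow (1 / 2) w‖ ^ 2 + X ^ 2 / Y ^ 2 * ‖stokesPow 1 w‖ ^ 2 = 2 * X ^ 2 := by
      rw [← hX, ← hY]
      field_simp
      ring
    rw [h2] at h1
    rw [Finset.mul_sum]
    refine le_trans (Finset.sum_le_sum fun k _ => ?_) (sum_le_hasSum s (fun k _ => ?_) h1)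
    · rw [mul_left_comm (X ^ 2 / Y ^ 2), ← mul_add]
      refine mul_le_mul_of_nonneg_left ?_ (by positivity)
      have e : q k = ‖coef (stokesPow (1 / 2) w) j k‖ ^ 2
          + X ^ 2 / Y ^ 2 * ‖coef (stokesPow 1 w) j k‖ ^ 2 := by
        rw [norm_coef_stokesPow hh, norm_coef_stokesPow hw, mul_pow, ← Real.sqrt_eq_rpow,
          Real.sq_sqrt (eigen_nonneg L k), Real.rpow_one]
        simp only [q]
        ring
      rw [e]
      refine add_le_add ?_ (mul_le_mul_of_nonneg_left ?_ (by positivity))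
      · exact Finset.single_le_sum (f := fun j => ‖coef (stokesPow (1 / 2) w) j k‖ ^ 2)
          (fun _ _ => sq_nonneg _) (Finset.mem_univ j)
      · exact Finset.single_le_sum (f := fun j => ‖coef (stokesPow 1 w) j k‖ ^ 2)
          (fun _ _ => sq_nonneg _) (Finset.mem_univ j)
    · positivity
  refine le_of_sq_le_sq (hcs.trans ?_) (by positivity)
  rw [mul_pow, mul_pow, ← Real.sqrt_eq_rpow, ← Real.sqrt_eq_rpow, Real.sq_sqrt hX0.le,
    Real.sq_sqrt hY0.le]
  have hqs' : ∑ k ∈ s, q k ≤ 2 * X ^ 2 / L ^ 3 := by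
    rw [le_div_iff₀ (by positivity), mul_comm]
    exact hqs
  calc (∑ k ∈ s, g k) * ∑ k ∈ s, q k
      ≤ ((L / (2 * Real.pi)) ^ 2 * (52 * N)) * (2 * X ^ 2 / L ^ 3) :=
        mul_le_mul hgs hqs' (Finset.sum_nonneg fun k _ => hq0 k) (by positivity)
    _ = 104 * (X * Y) / (2 * Real.pi) ^ 3 := by
        rw [hN]; field_simp; norm_num
    _ ≤ 104 * (X * Y) := div_le_self (by positivity) (one_le_pow₀ hpi)
    _ ≤ 11 ^ 2 * (X * Y) := by nlinarith [mul_pos hX0 hY0]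

/-- **Agmon's inequality** holds with a constant independent of the size of the box. -/
lemma agmonInequality (L : ℝ) [Fact (0 < L)] : AgmonInequality L 33 := by
  intro w hw
  by_cases h0 : w = 0
  · subst h0
    filter_upwards [Lp.coeFn_zero (EuclideanSpace ℝ (Fin 3)) 2 (volume : Measure (Torus L))]
      with x hx
    rw [hx]
    simp only [Pi.zero_apply, norm_zero]
    positivity
  have hs := sum_norm_coef_le hw h0
  have hsum : ∀ j, Summable fun k => ‖coef w j k‖ := fun j =>
    summable_of_sum_le (fun k => norm_nonneg _) (hs j)
  filter_upwards [ae_norm_le_tsum_coef w hsum] with x hx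
  refine hx.trans ?_
  refine (Finset.sum_le_sum fun j _ => (hsum j).tsum_le_of_sum_le (hs j)).trans_eq ?_
  -- `33 = 3 · 11`, one bound for each component.
  simp only [Finset.sum_const, Finset.card_univ, Fintype.card_fin, nsmul_eq_mul]
  push_cast
  ring

end Agmon

/-! ### One-variable tools: weak monotonicity, decay on the whole line, smoothing of cut-offs. -/

section RealAnalysis

lemma eq_zero_of_tsupport_subset_Icc {η : ℝ → ℝ} {T t : ℝ} (hs : tsupport η ⊆ Icc 0 T)
    (ht : t ∉ Icc 0 T) : η t = 0 :=
  image_eq_zero_of_notMem_tsupport fun h => ht (hs h)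

lemma eq_zero_of_tsupport_subset_Icc_of_le {η : ℝ → ℝ} {T t : ℝ} (hc : Continuous η)
    (hs : tsupport η ⊆ Icc 0 T) (ht : t ≤ 0) : η t = 0 := by
  have h : EqOn η 0 (closure (Iio (0 : ℝ))) :=
    EqOn.closure (fun s hs' => eq_zero_of_tsupport_subset_Icc hs fun h => absurd h.1 (not_le.2 hs'))
      hc continuous_zero
  rw [closure_Iio] at h
  exact h ht

lemma eq_zero_of_tsupport_subset_Icc_of_ge {η : ℝ → ℝ} {T t : ℝ} (hc : Continuous η)
    (hs : tsupport η ⊆ Icc 0 T) (ht : T ≤ t) : η t = 0 := by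
  have h : EqOn η 0 (closure (Ioi T)) :=
    EqOn.closure (fun s hs' => eq_zero_of_tsupport_subset_Icc hs fun h => absurd h.2 (not_le.2 hs'))
      hc continuous_zero
  rw [closure_Ioi] at h
  exact h ht

/-- An almost everywhere nonincreasing function has a nonpositive distributional derivative. -/
lemma integral_deriv_mul_nonneg_of_ae_antitone {η E : ℝ → ℝ} {T K : ℝ} (hT : 0 < T)
    (hη : ContDiff ℝ 1 η) (hη0 : ∀ t, 0 ≤ η t) (hs : tsupport η ⊆ Icc 0 T)
    (hK : ∀ t, |deriv η t| ≤ K) (hE : IntegrableOn E (Ioc 0 (T + 1)))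
    (hanti : ∀ᵐ t₀ ∂(volume.restrict (Ioi 0)), ∀ t₁, t₀ ≤ t₁ → E t₁ ≤ E t₀) :
    0 ≤ ∫ t in (0 : ℝ)..T, deriv η t * E t := by
  have hsd : tsupport (deriv η) ⊆ Icc 0 T := (closure_minimal support_deriv_subset
    (isClosed_tsupport η)).trans hs
  have hdc : Continuous (deriv η) := hη.continuous_deriv le_rfl
  -- The extra unit of time leaves room for shifts `h ≤ 1`, so truncation does not affect `E (t +
  -- h)` where `η t ≠ 0`.
  set F : ℝ → ℝ := (Ioc 0 (T + 1)).indicator E with hF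
  have hFi : Integrable F := (integrable_indicator_iff measurableSet_Ioc).2 hE
  have hηc := hη.continuous
  have hηcs : HasCompactSupport η := isCompact_Icc.of_isClosed_subset (isClosed_tsupport η) hs
  obtain ⟨B, hB⟩ := hηcs.exists_bound_of_continuous hηc
  have hprod : ∀ (g : ℝ → ℝ), Integrable g → ∀ h : ℝ, Integrable fun t => η (t - h) * g t := by
    intro g hg h
    exact hg.bdd_mul (c := B) (hηc.comp (continuous_id.sub continuous_const)).aestronglyMeasurable
      (.of_forall fun t => hB _)
  -- Since `E` need not be differentiable, `η'` is replaced by backward difference quotients;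
  -- translating the integral moves the difference onto `E`, where monotonicity gives the sign.
  -- Dominated convergence then recovers `η'`.
  have hdiff : ∀ n : ℕ, 0 ≤ ∫ t, ((n : ℝ) + 1) * (η t - η (t - 1 / ((n : ℝ) + 1))) * F t := by
    intro n
    set h : ℝ := 1 / ((n : ℝ) + 1) with hh
    have hpos : 0 < h := by positivity
    have hle : h ≤ 1 := by
      rw [hh, div_le_one (by positivity)]
      linarith [(n.cast_nonneg : (0 : ℝ) ≤ n)]
    have e : ∫ t, ((n : ℝ) + 1) * (η t - η (t - h)) * F t
        = ((n : ℝ) + 1) * ∫ t, η t * (F t - F (t + h)) := by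
      have h1 : ∫ t, η (t - h) * F t = ∫ t, η t * F (t + h) := by
        rw [← integral_add_right_eq_self _ h]
        simp
      have h0 : Integrable fun t => η t * F t := by simpa using hprod F hFi 0
      have h0' : Integrable fun t => η t * F (t + h) := by
        simpa using hprod _ (hFi.comp_add_right h) 0
      calc ∫ t, ((n : ℝ) + 1) * (η t - η (t - h)) * F t
          = ((n : ℝ) + 1) * ∫ t, (η t * F t - η (t - h) * F t) := by
            rw [← integral_const_mul]
            congr 1 with t
            ring
        _ = _ := by
            rw [integral_sub h0 (hprod F hFi h), h1, ← integral_sub h0 h0']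
            congr 2 with t
            ring
    rw [e]
    refine mul_nonneg (by positivity) (integral_nonneg_of_ae ?_)
    have hanti' := (ae_restrict_iff' measurableSet_Ioi).1 hanti
    filter_upwards [hanti'] with t ht
    by_cases h1 : t ≤ 0
    · simp [eq_zero_of_tsupport_subset_Icc_of_le hηc hs h1]
    by_cases h2 : T ≤ t
    · simp [eq_zero_of_tsupport_subset_Icc_of_ge hηc hs h2]
    push Not at h1 h2
    refine mul_nonneg (hη0 t) (sub_nonneg.2 ?_)
    rw [hF, indicator_of_mem (show t ∈ Ioc 0 (T + 1) from ⟨h1, by linarith⟩),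
      indicator_of_mem (show t + h ∈ Ioc 0 (T + 1) from ⟨by linarith, by linarith⟩)]
    exact ht h1 _ (by linarith)
  have hlim : Tendsto (fun n : ℕ => ∫ t, ((n : ℝ) + 1) * (η t - η (t - 1 / ((n : ℝ) + 1))) * F t)
      atTop (𝓝 (∫ t, deriv η t * F t)) := by
    refine tendsto_integral_of_dominated_convergence (fun t => K * ‖F t‖) (fun n => ?_)
      (hFi.norm.const_mul K) (fun n => .of_forall fun t => ?_) (.of_forall fun t => ?_)
    · refine AEStronglyMeasurable.mul ?_ hFi.aestronglyMeasurable
      exact Continuous.aestronglyMeasurable (by fun_prop)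
    · rw [norm_mul]
      refine mul_le_mul_of_nonneg_right ?_ (norm_nonneg _)
      have h1 := Convex.norm_image_sub_le_of_norm_deriv_le (f := η) (s := univ) (C := K)
        (x := t - 1 / ((n : ℝ) + 1)) (y := t)
        (fun x _ => (hη.differentiable one_ne_zero) x) (fun x _ => hK x) convex_univ
        (mem_univ _) (mem_univ _)
      have hn : (0 : ℝ) < (n : ℝ) + 1 := by positivity
      rw [norm_mul, Real.norm_of_nonneg hn.le]
      rw [sub_sub_cancel, Real.norm_of_nonneg (by positivity : (0 : ℝ) ≤ 1 / ((n : ℝ) + 1))] at h1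
      calc ((n : ℝ) + 1) * ‖η t - η (t - 1 / ((n : ℝ) + 1))‖
          ≤ ((n : ℝ) + 1) * (K * (1 / ((n : ℝ) + 1))) := by gcongr
        _ = K := by field_simp
    · refine Tendsto.mul_const _ ?_
      have h1 := ((hη.differentiable one_ne_zero) t).hasDerivAt.tendsto_slope_zero
      have h2 : Tendsto (fun n : ℕ => -(1 / ((n : ℝ) + 1))) atTop (𝓝[≠] 0) := by
        refine tendsto_nhdsWithin_iff.2 ⟨?_, .of_forall fun n => ?_⟩
        · simpa using (tendsto_one_div_add_atTop_nhds_zero_nat (𝕜 := ℝ)).neg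
        · have : (0 : ℝ) < 1 / ((n : ℝ) + 1) := by positivity
          exact (neg_lt_zero.2 this).ne
      refine (h1.comp h2).congr fun n => ?_
      have hn : (n : ℝ) + 1 ≠ 0 := by positivity
      simp only [Function.comp, smul_eq_mul, ← sub_eq_add_neg]
      field_simp
      ring
  have hnn := ge_of_tendsto' hlim hdiff
  have e : ∫ t, deriv η t * F t = ∫ t in (0 : ℝ)..T, deriv η t * E t := by
    rw [intervalIntegral.integral_of_le hT.le, ← integral_indicator measurableSet_Ioc]
    congr 1 with t
    by_cases ht : t ∈ Ioc 0 T
    · rw [indicator_of_mem ht, hF,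
        indicator_of_mem (show t ∈ Ioc 0 (T + 1) from ⟨ht.1, ht.2.trans (by linarith)⟩)]
    · rw [indicator_of_notMem ht]
      have : deriv η t = 0 := by
        by_cases h1 : t ≤ 0
        · exact eq_zero_of_tsupport_subset_Icc_of_le hdc hsd h1
        · push Not at h1
          exact eq_zero_of_tsupport_subset_Icc_of_ge hdc hsd
            (le_of_not_ge fun h => ht ⟨h1, h⟩)
      simp [this]
  rwa [e] at hnn

/-- Integration by parts against the primitive of an integrable function. -/
lemma integral_deriv_mul_primitive {η p : ℝ → ℝ} {T : ℝ}
    (hη : ContDiff ℝ 1 η) (hs : tsupport η ⊆ Icc 0 T) (hp : IntervalIntegrable p volume 0 T) :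
    ∫ t in (0 : ℝ)..T, deriv η t * ∫ s in (0 : ℝ)..t, p s = -∫ t in (0 : ℝ)..T, η t * p t := by
  have h1 := (hη.contDiffOn (s := uIcc 0 T)).absolutelyContinuousOnInterval
  have h2 := hp.absolutelyContinuousOnInterval_intervalIntegral (c := 0) (by simp)
  have h3 := h1.integral_mul_deriv_eq_deriv_mul h2
  rw [eq_zero_of_tsupport_subset_Icc_of_le hη.continuous hs le_rfl,
    eq_zero_of_tsupport_subset_Icc_of_ge hη.continuous hs le_rfl] at h3
  have h4 : ∫ t in (0 : ℝ)..T, η t * deriv (fun x => ∫ v in (0 : ℝ)..x, p v) t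
      = ∫ t in (0 : ℝ)..T, η t * p t := by
    refine intervalIntegral.integral_congr_ae ?_
    filter_upwards [hp.ae_hasDerivAt_integral] with t ht ht'
    rw [(ht (uIoc_subset_uIcc ht') 0 (by simp)).deriv]
  rw [h4] at h3
  linarith

/-- The weak form of an almost everywhere energy inequality. -/
lemma energy_defect_nonneg {η y p : ℝ → ℝ} {T K : ℝ} (hT : 0 < T)
    (hη : ContDiff ℝ 1 η) (hη0 : ∀ t, 0 ≤ η t) (hs : tsupport η ⊆ Icc 0 T)
    (hK : ∀ t, |deriv η t| ≤ K) (hy : ∀ b, 0 ≤ b → IntervalIntegrable y volume 0 b)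
    (hp : ∀ b, 0 ≤ b → IntervalIntegrable p volume 0 b)
    (hineq : ∀ᵐ t₀ ∂(volume.restrict (Ioi 0)), ∀ t₁, t₀ ≤ t₁ →
      y t₁ ≤ y t₀ + ∫ t in t₀..t₁, p t) :
    0 ≤ (∫ t in (0 : ℝ)..T, deriv η t * y t) + ∫ t in (0 : ℝ)..T, η t * p t := by
  have hT1 : (0 : ℝ) ≤ T + 1 := by linarith
  have hPi : ∀ b, 0 ≤ b → IntervalIntegrable (fun t => ∫ s in (0 : ℝ)..t, p s) volume 0 b := by
    intro b hb
    exact ((hp b hb).absolutelyContinuousOnInterval_intervalIntegral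
      (c := 0) (by simp)).continuousOn.intervalIntegrable
  -- Subtracting the primitive of `p` turns the inequality into almost everywhere monotonicity.
  have h1 := integral_deriv_mul_nonneg_of_ae_antitone (E := fun t => y t - ∫ s in (0 : ℝ)..t, p s)
    hT hη hη0 hs hK
    ((intervalIntegrable_iff_integrableOn_Ioc_of_le hT1).1 ((hy _ hT1).sub (hPi _ hT1))) (by
      filter_upwards [hineq, ae_restrict_mem measurableSet_Ioi] with t₀ h h0 t₁ h01
      have h0' : (0 : ℝ) < t₀ := h0
      have := h t₁ h01
      rw [← intervalIntegral.integral_interval_sub_left (hp t₁ (by linarith)) (hp t₀ h0'.le)]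
        at this
      linarith)
  have hdc : Continuous (deriv η) := hη.continuous_deriv le_rfl
  have e : ∫ t in (0 : ℝ)..T, deriv η t * (y t - ∫ s in (0 : ℝ)..t, p s)
      = (∫ t in (0 : ℝ)..T, deriv η t * y t)
        - ∫ t in (0 : ℝ)..T, deriv η t * ∫ s in (0 : ℝ)..t, p s := by
    rw [← intervalIntegral.integral_sub ((hy T hT.le).continuousOn_mul hdc.continuousOn)
      ((hPi T hT.le).continuousOn_mul hdc.continuousOn)]
    simp only [mul_sub]
  rw [e, integral_deriv_mul_primitive hη hs (hp T hT.le)] at h1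
  linarith

/-- A bounded function on the whole line that decays exponentially forward in time is
nonpositive. -/
lemma nonpos_of_bounded_of_decay {z : ℝ → ℝ} {K c : ℝ} (hc : 0 < c) (hK : ∀ t, |z t| ≤ K)
    (hz : ∀ a b, IntervalIntegrable z volume a b)
    (hineq : ∀ᵐ t₀, ∀ t₁, t₀ ≤ t₁ → z t₁ ≤ z t₀ - c * ∫ t in t₀..t₁, z t) (t : ℝ) : z t ≤ 0 := by
  by_contra! hpos
  have hbdd : BddAbove (range z) := ⟨K, by rintro _ ⟨s, rfl⟩; exact (abs_le.1 (hK s)).2⟩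
  -- `z` may be discontinuous and its supremum need not be attained, so the argument uses a time `r`
  -- where `z` is almost maximal. A drop over a short interval before `r` would force an earlier
  -- value above `m`.
  set m := sSup (range z) with hm
  have hle : ∀ s, z s ≤ m := fun s => le_csSup hbdd ⟨s, rfl⟩
  have hm0 : 0 < m := hpos.trans_le (hle t)
  have hK0 : 0 < K := hpos.trans_le ((le_abs_self _).trans (hK t))
  set d := m / (4 * (c * K)) with hd
  have hd0 : 0 < d := by positivity
  have hcd : c * K * d = m / 4 := by rw [hd]; field_simp
  obtain ⟨_, ⟨r, rfl⟩, hr⟩ := exists_lt_of_lt_csSup (range_nonempty z)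
    (show m - min (m / 4) (c * d * m / 8) < m by
      have : 0 < min (m / 4) (c * d * m / 8) := by positivity
      linarith)
  have hr1 : m - m / 4 < z r := by linarith [min_le_left (m / 4) (c * d * m / 8)]
  have hr2 : m - c * d * m / 8 < z r := by linarith [min_le_right (m / 4) (c * d * m / 8)]
  -- `z` can rise by at most `cKd = m/4` on this interval, and it ends above `3m/4`.
  have hlow : ∀ᵐ s, s ∈ Ioc (r - d) r → m / 2 ≤ z s := by
    filter_upwards [hineq] with s hs hsr
    have h1 := hs r hsr.2
    have h2 : -(K * (r - s)) ≤ ∫ t in s..r, z t := by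
      have := intervalIntegral.norm_integral_le_of_norm_le_const (f := z) (a := s) (b := r)
        (C := K) fun x _ => hK x
      rw [abs_of_nonneg (by linarith [hsr.2] : 0 ≤ r - s), Real.norm_eq_abs] at this
      exact (abs_le.1 this).1
    have h3 : c * K * (r - s) ≤ c * K * d :=
      mul_le_mul_of_nonneg_left (by linarith [hsr.1]) (by positivity)
    nlinarith [mul_le_mul_of_nonneg_left h2 hc.le]
  -- An admissible starting time at distance at least `d/2` from `r`: the decay up to `r` is then at
  -- least `cdm/4`, twice the permitted gap `cdm/8`.
  obtain ⟨s, hs, hsd⟩ : ∃ s, (∀ t₁, s ≤ t₁ → z t₁ ≤ z s - c * ∫ t in s..t₁, z t) ∧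
      s ∈ Ioo (r - d) (r - d / 2) := by
    have hfr : ∃ᵐ s, s ∈ Ioo (r - d) (r - d / 2) := by
      rw [frequently_ae_mem_iff, Real.volume_Ioo]
      simp only [ne_eq, ENNReal.ofReal_eq_zero, not_le]
      linarith
    exact (hfr.and_eventually hineq).exists.imp fun s h => ⟨h.2, h.1⟩
  have h1 := hs r (by linarith [hsd.2])
  have h2 : (r - s) * (m / 2) ≤ ∫ t in s..r, z t := by
    have : ∫ _ in s..r, m / 2 ≤ ∫ t in s..r, z t := by
      refine intervalIntegral.integral_mono_ae_restrict (by linarith [hsd.2])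
        intervalIntegrable_const (hz s r) ?_
      rw [EventuallyLE, ← restrict_Ioc_eq_restrict_Icc, ae_restrict_iff' measurableSet_Ioc]
      filter_upwards [hlow] with x hx hx'
      exact hx ⟨by linarith [hx'.1, hsd.1], hx'.2⟩
    rwa [intervalIntegral.integral_const, smul_eq_mul] at this
  have h3 : d / 2 * (m / 2) ≤ (r - s) * (m / 2) :=
    mul_le_mul_of_nonneg_right (by linarith [hsd.2]) (by positivity)
  have h4 : c * (d / 2 * (m / 2)) ≤ c * ∫ t in s..r, z t :=
    mul_le_mul_of_nonneg_left (h3.trans h2) hc.le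
  have h5 := hle s
  have h6 : 0 < c * d * m := by positivity
  nlinarith

/-- A `C¹` cut-off on `[0,T]` is a `C¹` limit of smooth functions supported in the open half-line. -/
lemma exists_smooth_approx {η : ℝ → ℝ} {T ε : ℝ} (hη : ContDiff ℝ 1 η)
    (hs : tsupport η ⊆ Icc 0 T) (hε : 0 < ε) :
    ∃ φ : ℝ → ℝ, ContDiff ℝ (⊤ : ℕ∞) φ ∧ tsupport φ ⊆ Ioi 0 ∧ tsupport φ ⊆ Icc 0 (T + 1) ∧
      ∀ t, |φ t - η t| ≤ ε ∧ |deriv φ t - deriv η t| ≤ ε := by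
  have hηc := hη.continuous
  have hdc : Continuous (deriv η) := hη.continuous_deriv le_rfl
  have hcs : HasCompactSupport η := isCompact_Icc.of_isClosed_subset (isClosed_tsupport η) hs
  have hcd : HasCompactSupport (deriv η) := hcs.deriv
  obtain ⟨d₁, hd₁, h₁⟩ := Metric.uniformContinuous_iff.1
    (hcs.uniformContinuous_of_continuous hηc) (ε / 2) (by positivity)
  obtain ⟨d₂, hd₂, h₂⟩ := Metric.uniformContinuous_iff.1
    (hcd.uniformContinuous_of_continuous hdc) (ε / 2) (by positivity)
  -- Shifting right by `2r` and mollifying at scale `r` puts the support in `[r, T + 3r]`, inside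
  -- both the open half-line and `[0, T + 1]`.
  set r : ℝ := min (min d₁ d₂) 1 / 4 with hr
  have hr0 : 0 < r := by positivity
  have hr1 : 2 * r < d₁ := by
    have := (min_le_left (min d₁ d₂) 1).trans (min_le_left d₁ d₂); linarith
  have hr2 : 2 * r < d₂ := by
    have := (min_le_left (min d₁ d₂) 1).trans (min_le_right d₁ d₂); linarith
  have hr3 : 4 * r ≤ 1 := by
    have := min_le_right (min d₁ d₂) 1; linarith
  let ρ : ContDiffBump (0 : ℝ) := ⟨r / 2, r, by positivity, by linarith⟩
  set ψ : ℝ → ℝ := fun t => η (t - 2 * r) with hψ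
  have hψd : ContDiff ℝ 1 ψ := hη.comp (contDiff_id.sub contDiff_const)
  have hψ' : deriv ψ = fun t => deriv η (t - 2 * r) := by
    ext t; rw [hψ, deriv_comp_sub_const]
  have hψz : ∀ t, t ∉ Icc (2 * r) (T + 2 * r) → ψ t = 0 := fun t ht =>
    eq_zero_of_tsupport_subset_Icc (η := η) (t := t - 2 * r) hs fun h => ht ⟨by linarith [h.1], by linarith [h.2]⟩
  have hψcs : HasCompactSupport ψ := HasCompactSupport.intro isCompact_Icc hψz
  set φ : ℝ → ℝ := MeasureTheory.convolution (ρ.normed volume) ψ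
    (ContinuousLinearMap.lsmul ℝ ℝ) volume with hφ
  have hnl : LocallyIntegrable (ρ.normed volume) volume := ρ.continuous_normed.locallyIntegrable
  have hφd : ∀ t, deriv φ t = MeasureTheory.convolution (ρ.normed volume) (deriv ψ)
      (ContinuousLinearMap.lsmul ℝ ℝ) volume t := fun t =>
    (hψcs.hasDerivAt_convolution_right _ hnl hψd t).deriv
  have hsupp : tsupport φ ⊆ Icc r (T + 3 * r) := by
    refine closure_minimal (fun t ht => ?_) isClosed_Icc
    by_contra hcon
    apply ht
    have hz : ∀ x ∈ Metric.ball t ρ.rOut, ψ x = 0 := by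
      intro x hx
      rw [Metric.mem_ball, Real.dist_eq, abs_lt] at hx
      have hx1 : -r < x - t := hx.1
      have hx2 : x - t < r := hx.2
      refine hψz x fun h => hcon ⟨?_, ?_⟩ <;> linarith [h.1, h.2]
    have ht0 : ψ t = 0 := hz t (Metric.mem_ball_self ρ.rOut_pos)
    rw [hφ, ρ.normed_convolution_eq_right fun x hx => (hz x hx).trans ht0.symm, ht0]
  refine ⟨φ, ?_, fun t ht => ?_, fun t ht => ?_, fun t => ⟨?_, ?_⟩⟩
  · exact ρ.hasCompactSupport_normed.contDiff_convolution_left _ ρ.contDiff_normed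
      hψd.continuous.locallyIntegrable
  · exact hr0.trans_le (hsupp ht).1
  · exact ⟨hr0.le.trans (hsupp ht).1, (hsupp ht).2.trans (by linarith)⟩
  · have e1 : dist (φ t) (ψ t) ≤ ε / 2 := by
      refine ρ.dist_normed_convolution_le hψd.continuous.aestronglyMeasurable fun x hx => (h₁ ?_).le
      rw [Metric.mem_ball] at hx
      rw [dist_sub_right]
      exact hx.trans (by change r < d₁; linarith)
    have e2 : dist (ψ t) (η t) ≤ ε / 2 := by
      refine (h₁ ?_).le
      rw [Real.dist_eq, sub_sub_cancel_left, abs_neg, abs_of_pos (by positivity)]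
      exact hr1
    rw [← Real.dist_eq]
    linarith [dist_triangle (φ t) (ψ t) (η t)]
  · have e1 : dist (deriv φ t) (deriv ψ t) ≤ ε / 2 := by
      rw [hφd]
      refine ρ.dist_normed_convolution_le
        (hψd.continuous_deriv le_rfl).aestronglyMeasurable fun x hx => ?_
      rw [hψ']
      refine (h₂ ?_).le
      rw [Metric.mem_ball] at hx
      rw [dist_sub_right]
      exact hx.trans (by change r < d₂; linarith)
    have e2 : dist (deriv ψ t) (deriv η t) ≤ ε / 2 := by
      rw [hψ']
      refine (h₂ ?_).le
      rw [Real.dist_eq, sub_sub_cancel_left, abs_neg, abs_of_pos (by positivity)]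
      exact hr2
    rw [← Real.dist_eq]
    linarith [dist_triangle (deriv φ t) (deriv ψ t) (deriv η t)]

end RealAnalysis

/-! ### Leray–Hopf solutions: integrability, absorbing bound, energy defect, tested equation. -/

section LerayHopf

variable {L : ℝ} [Fact (0 < L)] {ν a : ℝ} {f : VecField L} {u : ℝ → VecField L}

lemma IsLerayHopf.continuous_inner (h : IsLerayHopf ν f a u) (v : VecField L) :
    Continuous fun t => inner ℝ (u (max a t)) v := by
  refine (h.weak_continuous v).comp_continuous (continuous_const.max continuous_id) fun t => ?_
  exact le_max_left a t

/-- The norm is lower semicontinuous along a weakly continuous curve: pair `u s` with `u t` and use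
Cauchy–Schwarz. The `max` extends the curve constantly to the left of `a`. -/
lemma IsLerayHopf.measurable_norm (h : IsLerayHopf ν f a u) :
    Measurable fun t => ‖u (max a t)‖ := by
  refine LowerSemicontinuous.measurable fun t c hc => ?_
  have h1 := (h.continuous_inner (u (max a t))).tendsto t
  by_cases h0 : ‖u (max a t)‖ = 0
  · exact .of_forall fun s => by
      have : c < 0 := by simpa [h0] using hc
      exact this.trans_le (norm_nonneg _)
  have hpos : 0 < ‖u (max a t)‖ := lt_of_le_of_ne (norm_nonneg _) (Ne.symm h0)
  have h2 : c * ‖u (max a t)‖ < inner ℝ (u (max a t)) (u (max a t)) := by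
    rw [real_inner_self_eq_norm_sq, sq]
    exact mul_lt_mul_of_pos_right hc hpos
  filter_upwards [h1.eventually_const_lt h2] with s hs
  exact lt_of_mul_lt_mul_right (hs.trans_le (real_inner_le_norm _ _)) hpos.le

lemma IsLerayHopf.intervalIntegrable_norm_pow (h : IsLerayHopf ν f a u) (n : ℕ) {s t : ℝ}
    (hs : a ≤ s) (ht : a ≤ t) : IntervalIntegrable (fun r => ‖u r‖ ^ n) volume s t := by
  obtain ⟨M, hM⟩ := h.bounded
  have h1 : IntervalIntegrable (fun r => ‖u (max a r)‖ ^ n) volume s t := by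
    refine intervalIntegrable_const.mono_fun' (g := fun _ => M ^ n)
      (h.measurable_norm.pow_const n).aestronglyMeasurable (.of_forall fun r => ?_)
    simp only [norm_pow, norm_norm]
    exact pow_le_pow_left₀ (norm_nonneg _) (hM _ (le_max_left _ _)) n
  refine h1.congr fun r hr => ?_
  have : a ≤ r := (le_min hs ht).trans hr.1.le
  simp only [max_eq_right this]

lemma IsLerayHopf.intervalIntegrable_inner (h : IsLerayHopf ν f a u) (v : VecField L) {s t : ℝ}
    (hs : a ≤ s) (ht : a ≤ t) : IntervalIntegrable (fun r => inner ℝ v (u r)) volume s t := by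
  refine ((h.weak_continuous v).mono fun r hr => ?_).intervalIntegrable.congr fun r _ => ?_
  · exact (le_min hs ht).trans hr.1
  · exact real_inner_comm _ _

lemma IsLerayHopf.intervalIntegrable_gradSq_of_lt (h : IsLerayHopf ν f a u) {s t : ℝ}
    (hs : a < s) (hst : s ≤ t) : IntervalIntegrable (fun r => gradSq (u r)) volume s t := by
  rw [intervalIntegrable_iff_integrableOn_Ioc_of_le hst]
  have h1 := h.grad_sq_integrable.integrableOn_compact_subset
    (t := Icc s t) (fun r hr => hs.trans_le hr.1) isCompact_Icc
  exact h1.mono_set Ioc_subset_Icc_self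

lemma ae_exists_mem_Ioo {p : ℝ → Prop} {b c : ℝ} (hbc : b < c)
    (h : ∀ᵐ t ∂(volume.restrict (Ioi b)), p t) : ∃ t ∈ Ioo b c, p t := by
  have h' := (ae_restrict_iff' measurableSet_Ioi).1 h
  have hfr : ∃ᵐ s, s ∈ Ioo b c := by
    rw [frequently_ae_mem_iff, Real.volume_Ioo]
    simpa using hbc
  obtain ⟨t, ht, ht'⟩ := (hfr.and_eventually h').exists
  exact ⟨t, ht, ht' ht.1⟩

/-- The energy inequality makes `‖∇u‖²` integrable up to the initial time. -/
lemma IsLerayHopf.intervalIntegrable_gradSq (h : IsLerayHopf ν f a u) (hν : 0 < ν) {b : ℝ}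
    (hb : a ≤ b) : IntervalIntegrable (fun r => gradSq (u r)) volume a b := by
  rcases hb.eq_or_lt with rfl | hb
  · exact IntervalIntegrable.refl
  rw [intervalIntegrable_iff_integrableOn_Ioc_of_le hb.le]
  obtain ⟨M, hM⟩ := h.bounded
  have hM0 : 0 ≤ M := (norm_nonneg _).trans (hM a le_rfl)
  -- The energy inequality may fail from `a` itself, so it is used from admissible times decreasing
  -- to `a`, with a bound independent of `n`.
  choose s hs hs' using fun n : ℕ => ae_exists_mem_Ioo (b := a)
    (c := min b (a + 1 / ((n : ℝ) + 1)))
    (lt_min hb (by have : (0 : ℝ) < 1 / ((n : ℝ) + 1) := by positivity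
                   linarith)) h.energy_ineq
  have hsb : ∀ n, s n ≤ b := fun n => (hs n).2.le.trans (min_le_left _ _)
  have hlim : Tendsto s atTop (𝓝 a) := by
    have h1 : Tendsto (fun n : ℕ => a + 1 / ((n : ℝ) + 1)) atTop (𝓝 (a + 0)) :=
      tendsto_const_nhds.add tendsto_one_div_add_atTop_nhds_zero_nat
    rw [add_zero] at h1
    exact tendsto_of_tendsto_of_tendsto_of_le_of_le tendsto_const_nhds h1
      (fun n => (hs n).1.le) fun n => (hs n).2.le.trans (min_le_right _ _)
  refine integrableOn_Ioc_of_intervalIntegral_norm_bounded_left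
    (I := (M ^ 2 / 2 + ‖f‖ * M * (b - a)) / ν) (a := s) (l := atTop)
    (fun n => (intervalIntegrable_iff_integrableOn_Ioc_of_le (hsb n)).1
      (h.intervalIntegrable_gradSq_of_lt (hs n).1 (hsb n))) hlim (.of_forall fun n => ?_)
  simp only [Real.norm_of_nonneg (gradSq_nonneg _)]
  rw [← intervalIntegral.integral_of_le (hsb n), le_div_iff₀ hν, mul_comm]
  refine (hs' n b (hsb n)).trans ?_
  have h1 : ‖u (s n)‖ ^ 2 ≤ M ^ 2 := pow_le_pow_left₀ (norm_nonneg _) (hM _ (hs n).1.le) 2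
  have h2 : ‖∫ t in (s n)..b, inner ℝ f (u t)‖ ≤ ‖f‖ * M * |b - s n| := by
    refine intervalIntegral.norm_integral_le_of_norm_le_const fun r hr => ?_
    rw [uIoc_of_le (hsb n)] at hr
    exact (norm_inner_le_norm _ _).trans
      (mul_le_mul_of_nonneg_left (hM _ ((hs n).1.le.trans hr.1.le)) (norm_nonneg _))
  rw [abs_of_nonneg (sub_nonneg.2 (hsb n))] at h2
  have h3 : ‖f‖ * M * (b - s n) ≤ ‖f‖ * M * (b - a) :=
    mul_le_mul_of_nonneg_left (by linarith [(hs n).1]) (by positivity)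
  have h4 := (le_abs_self _).trans (h2.trans h3)
  have h5 := sq_nonneg ‖u b‖
  linarith

/-- Points of the weak attractor satisfy the absorbing bound. -/
lemma norm_le_of_mem_weakAttractor (hν : 0 < ν) {w : VecField L} (hw : w ∈ weakAttractor ν f) :
    ‖w‖ ≤ ‖f‖ / (ν * (2 * Real.pi / L) ^ 2) := by
  obtain ⟨v, hv, ⟨M, hM⟩, rfl⟩ := hw
  have hL : 0 < L := Fact.out
  have hpi := Real.pi_pos
  set lam := (2 * Real.pi / L) ^ 2 with hlam
  have hlam0 : 0 < lam := by positivity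
  set g := ‖f‖ / (ν * lam) with hg
  have hg0 : 0 ≤ g := by positivity
  have hfg : ‖f‖ = ν * lam * g := by rw [hg]; field_simp
  have hsq : ∀ s t, IntervalIntegrable (fun r => ‖v r‖ ^ 2) volume s t := fun s t =>
    (hv (min s t)).intervalIntegrable_norm_pow 2 (min_le_left _ _) (min_le_right _ _)
  have hbd : ∀ t, |‖v t‖ ^ 2 - g ^ 2| ≤ M ^ 2 + g ^ 2 := by
    intro t
    have h1 : ‖v t‖ ^ 2 ≤ M ^ 2 := pow_le_pow_left₀ (norm_nonneg _) (hM t) 2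
    rw [abs_le]
    constructor <;> nlinarith [sq_nonneg ‖v t‖, sq_nonneg g]
  have hall : ∀ᵐ t₀, ∀ t₁, t₀ ≤ t₁ →
      ‖v t₁‖ ^ 2 - g ^ 2 ≤ ‖v t₀‖ ^ 2 - g ^ 2 - ν * lam * ∫ t in t₀..t₁, (‖v t‖ ^ 2 - g ^ 2) := by
    -- Countably many half-lines suffice, so the exceptional null sets can be united.
    have h1 : ∀ n : ℕ, ∀ᵐ t₀, t₀ ∈ Ioi (-(n : ℝ)) → ∀ t₁, t₀ ≤ t₁ →
        ν * (∫ t in t₀..t₁, gradSq (v t))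
          ≤ ‖v t₀‖ ^ 2 / 2 - ‖v t₁‖ ^ 2 / 2 + ∫ t in t₀..t₁, inner ℝ f (v t) := fun n =>
      (ae_restrict_iff' measurableSet_Ioi).1 (hv (-(n : ℝ))).energy_ineq
    filter_upwards [ae_all_iff.2 h1] with t₀ h2 t₁ h01
    obtain ⟨n, hn⟩ := exists_nat_gt (-t₀)
    have h3 := h2 n (by rw [mem_Ioi]; linarith) t₁ h01
    have hat : t₀ - 1 ≤ t₀ := by linarith
    have hat1 : t₀ - 1 ≤ t₁ := by linarith
    have hgi := (hv (t₀ - 1)).intervalIntegrable_gradSq_of_lt (by linarith) h01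
    have h4 : lam * ∫ t in t₀..t₁, ‖v t‖ ^ 2 ≤ ∫ t in t₀..t₁, gradSq (v t) := by
      rw [← intervalIntegral.integral_const_mul]
      refine intervalIntegral.integral_mono_ae_restrict h01 ((hsq _ _).const_mul _) hgi ?_
      rw [EventuallyLE, ← restrict_Ioc_eq_restrict_Icc]
      have hV := (hv (t₀ - 1)).mem_V
      refine ae_mono (Measure.restrict_mono (fun r hr => ?_) le_rfl) (hV.mono fun r hr => poincare hr)
      exact lt_of_lt_of_le (by linarith) hr.1.le
    -- Young's inequality with `‖f‖ = νλg`; half of the Poincaré dissipation absorbs the `‖v‖²`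
    -- part.
    have h5 : ∫ t in t₀..t₁, inner ℝ f (v t)
        ≤ ∫ t in t₀..t₁, (ν * lam / 2) * (‖v t‖ ^ 2 + g ^ 2) := by
      refine intervalIntegral.integral_mono_on h01
        ((hv (t₀ - 1)).intervalIntegrable_inner f hat hat1)
        (((hsq _ _).add intervalIntegrable_const).const_mul _) fun t _ => ?_
      refine (real_inner_le_norm _ _).trans ?_
      rw [hfg]
      have : 0 < ν * lam := by positivity
      nlinarith [mul_nonneg this.le (sq_nonneg (‖v t‖ - g))]
    rw [intervalIntegral.integral_const_mul, intervalIntegral.integral_add (hsq _ _)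
      intervalIntegrable_const] at h5
    rw [intervalIntegral.integral_sub (hsq _ _) intervalIntegrable_const]
    have h6 := mul_le_mul_of_nonneg_left h4 hν.le
    nlinarith
  have hz := nonpos_of_bounded_of_decay (z := fun t => ‖v t‖ ^ 2 - g ^ 2) (c := ν * lam)
    (by positivity) hbd (fun s t => (hsq s t).sub intervalIntegrable_const) hall 0
  exact le_of_sq_le_sq (by linarith) hg0

lemma IsTimeCutoff.abs_deriv_le {C₀ δ T : ℝ} {η : ℝ → ℝ} (h : IsTimeCutoff C₀ δ T η)
    (hC₀ : 0 < C₀) (hT : 0 < T) (hδ : 0 < δ) (t : ℝ) : |deriv η t| ≤ C₀ / T :=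
  (h.deriv_bound t).trans (mul_le_of_le_one_right (by positivity)
    (Real.rpow_le_one (h.nonneg t) (h.le_one t) hδ.le))

/-- The anomalous dissipation of a Leray–Hopf solution is nonnegative. -/
lemma anomalousDissipation_nonneg {C₀ δ T R₀ : ℝ} {η : ℝ → ℝ} (hu : IsLerayHopf ν f 0 u)
    (hη : IsTimeCutoff C₀ δ T η) (hν : 0 < ν) (hC₀ : 0 < C₀) (hδ : 0 < δ) (hT : 0 < T)
    (hR : 0 < R₀) : 0 ≤ anomalousDissipation ν R₀ T f η u := by
  have hG : ∀ b, 0 ≤ b → IntervalIntegrable (fun r => gradSq (u r)) volume 0 b := fun b hb =>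
    hu.intervalIntegrable_gradSq hν hb
  have hI : ∀ b, 0 ≤ b → IntervalIntegrable (fun r => inner ℝ f (u r)) volume 0 b := fun b hb =>
    hu.intervalIntegrable_inner f le_rfl hb
  have h := energy_defect_nonneg (y := fun t => ‖u t‖ ^ 2 / 2)
    (p := fun t => inner ℝ f (u t) - ν * gradSq (u t)) hT hη.contDiff hη.nonneg hη.support
    (hη.abs_deriv_le hC₀ hT hδ)
    (fun b hb => (hu.intervalIntegrable_norm_pow 2 le_rfl hb).div_const 2)
    (fun b hb => (hI b hb).sub ((hG b hb).const_mul ν)) (by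
      filter_upwards [hu.energy_ineq, ae_restrict_mem measurableSet_Ioi] with t₀ h h0 t₁ h01
      have h0' : (0 : ℝ) < t₀ := h0
      rw [intervalIntegral.integral_sub (hu.intervalIntegrable_inner f h0'.le (h0'.le.trans h01))
        ((hu.intervalIntegrable_gradSq_of_lt h0' h01).const_mul ν),
        intervalIntegral.integral_const_mul]
      linarith [h t₁ h01])
  have hc : ContinuousOn η (uIcc 0 T) := hη.contDiff.continuous.continuousOn
  have e : ∫ t in (0 : ℝ)..T, η t * (inner ℝ f (u t) - ν * gradSq (u t))
      = (∫ t in (0 : ℝ)..T, η t * inner ℝ f (u t)) - ν * ∫ t in (0 : ℝ)..T, η t * gradSq (u t) := by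
    rw [← intervalIntegral.integral_const_mul, ← intervalIntegral.integral_sub
      ((hI T hT.le).continuousOn_mul hc) (((hG T hT.le).continuousOn_mul hc).const_mul ν)]
    congr 1 with t
    ring
  rw [e] at h
  rw [anomalousDissipation, viscousDissipation, ← mul_add, ← mul_sub]
  refine mul_nonneg (by positivity) ?_
  linarith

/-- Integrals over a longer interval of functions vanishing beyond `T`. -/
lemma setIntegral_Icc_eq_intervalIntegral {g : ℝ → ℝ} {T T' : ℝ} (hT : 0 ≤ T) (hT' : T ≤ T')
    (hg : ∀ t, T < t → g t = 0) : ∫ t in Icc 0 T', g t = ∫ t in (0 : ℝ)..T, g t := by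
  rw [integral_Icc_eq_integral_Ioc, intervalIntegral.integral_of_le hT]
  refine setIntegral_eq_of_subset_of_forall_sdiff_eq_zero measurableSet_Ioc
    (Ioc_subset_Ioc_right hT') fun t ht => hg t ?_
  by_contra! h
  exact ht.2 ⟨ht.1.1, h⟩

lemma norm_integral_le_setIntegral {g b : ℝ → ℝ} {J : Set ℝ} (hJ : MeasurableSet J)
    (hb : IntegrableOn b J) (h0 : ∀ t, t ∉ J → g t = 0) (h : ∀ᵐ t, t ∈ J → |g t| ≤ b t) :
    |∫ t, g t| ≤ ∫ t in J, b t := by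
  rw [← integral_indicator hJ, ← Real.norm_eq_abs]
  refine norm_integral_le_of_norm_le ((integrable_indicator_iff hJ).2 hb) ?_
  filter_upwards [h] with t ht
  by_cases htJ : t ∈ J
  · rw [indicator_of_mem htJ]; exact ht htJ
  · rw [indicator_of_notMem htJ, h0 t htJ, norm_zero]

/-- The weak formulation tested against `η A^{-1}f`. -/
lemma weak_form_bound {C₀ δ T C_A : ℝ} {η : ℝ → ℝ} (hu : IsLerayHopf ν f 0 u)
    (hη : IsTimeCutoff C₀ δ T η) (hν : 0 < ν) (hC₀ : 0 < C₀) (hδ : 0 < δ) (hδ1 : δ < 1)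
    (hT : 0 < T) (hCA : 0 < C_A) (hagmon : AgmonInequality L C_A)
    (hf : f ∈ stokesDom L (1 / 2)) (hf0 : f ≠ 0) :
    ‖stokesPow (-(1 / 2)) f‖ ^ 2 * ∫ t in (0 : ℝ)..T, η t
      ≤ ν * gammaF ν C₀ T f * ‖f‖ * (∫ t in (0 : ℝ)..T, η t ^ δ * ‖u t‖)
        + C_A * (‖f‖ ^ (1 / 2 : ℝ) * ‖stokesPow (1 / 2) f‖ ^ (1 / 2 : ℝ))
          * ∫ t in (0 : ℝ)..T, η t ^ δ * ‖u t‖ ^ 2 := by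
  have hfH := mem_H_of_mem_stokesDom hf
  obtain ⟨M, hM⟩ := hu.bounded
  set v := stokesPow (-1) f with hv
  set D := ‖stokesPow (-(1 / 2)) f‖ ^ 2 with hD
  set F := C_A * (‖f‖ ^ (1 / 2 : ℝ) * ‖stokesPow (1 / 2) f‖ ^ (1 / 2 : ℝ)) with hF
  set U : ℝ → ℝ := fun t => ‖u (max 0 t)‖ with hU
  set J : Set ℝ := Icc 0 (T + 1) with hJ
  have hF0 : 0 ≤ F := by positivity
  have hU0 : ∀ t, 0 ≤ U t := fun t => norm_nonneg _
  have hUM : ∀ t, U t ≤ M := fun t => hM _ (le_max_left _ _)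
  have hM0 : 0 ≤ M := (hU0 0).trans (hUM 0)
  have hUu : ∀ t, 0 ≤ t → U t = ‖u t‖ := fun t ht => by simp only [hU, max_eq_right ht]
  have hint : ∀ α : ℝ → ℝ, Continuous α → ∀ n : ℕ, IntegrableOn (fun t => α t * U t ^ n) J := by
    intro α hα n
    refine Integrable.mul_bdd (c := M ^ n) (hα.integrableOn_Icc)
      (hu.measurable_norm.pow_const n).aestronglyMeasurable (.of_forall fun t => ?_)
    rw [norm_pow, norm_norm]
    exact pow_le_pow_left₀ (norm_nonneg _) (hUM t) n
  have hηc := hη.contDiff.continuous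
  have hdc : Continuous (deriv η) := hη.contDiff.continuous_deriv le_rfl
  have hδc : Continuous fun t => η t ^ δ := hηc.rpow_const fun t => Or.inr hδ.le
  -- `γ_f` merges the two linear contributions, from the time derivative and from the viscosity.
  have hγ : ν * gammaF ν C₀ T f * ‖f‖ = C₀ / T * ‖v‖ + ν * ‖f‖ := by
    have : ‖f‖ ≠ 0 := norm_ne_zero_iff.2 hf0
    rw [gammaF, ← hv]
    field_simp
  set B := ∫ t in J, (η t ^ δ * (ν * gammaF ν C₀ T f * ‖f‖) * U t ^ 1 + η t ^ δ * F * U t ^ 2)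
    with hB
  have hBint : IntegrableOn (fun t => η t ^ δ * (ν * gammaF ν C₀ T f * ‖f‖) * U t ^ 1
      + η t ^ δ * F * U t ^ 2) J :=
    (hint _ (hδc.mul continuous_const) 1).add (hint _ (hδc.mul continuous_const) 2)
  set K := ‖v‖ * M + ν * ‖f‖ * M + F * M ^ 2 + D with hK
  have hvol : volume.real J = T + 1 := by
    rw [hJ, Real.volume_real_Icc_of_le (by linarith), sub_zero]
  -- `η` is only `C¹` and may have support touching `0`, so the equation is tested with a smooth `φ`
  -- that is `ε`-close in `C¹`; `K` collects the resulting errors.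
  have key : ∀ ε : ℝ, 0 < ε → D * ∫ t in J, η t ≤ B + (T + 1) * K * ε := by
    intro ε hε
    obtain ⟨φ, hφ, hφ0, hφJ, hφη⟩ := exists_smooth_approx hη.contDiff hη.support hε
    have hcs : HasCompactSupport φ := isCompact_Icc.of_isClosed_subset (isClosed_tsupport φ) hφJ
    have hφz : ∀ t, t ∉ J → φ t = 0 := fun t ht =>
      image_eq_zero_of_notMem_tsupport fun h => ht (hφJ h)
    have hφz' : ∀ t, t ∉ J → deriv φ t = 0 := fun t ht =>
      image_eq_zero_of_notMem_tsupport fun h => ht (hφJ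
        (closure_minimal support_deriv_subset (isClosed_tsupport φ) h))
    have hwf := hu.weak_form v (stokesPow_neg_one_mem_V hfH) φ hφ hcs hφ0
    rw [integral_mul_const, inner_stokesPow_neg_one hfH] at hwf
    have hφle : ∀ t, |φ t| ≤ η t + ε := fun t => by
      have := abs_le.1 (hφη t).1
      rw [abs_le]
      constructor <;> linarith [hη.nonneg t]
    have hφle' : ∀ t, |deriv φ t| ≤ |deriv η t| + ε := fun t => by
      linarith [abs_sub_abs_le_abs_sub (deriv φ t) (deriv η t), (hφη t).2]
    have b1i := hint (fun t => (|deriv η t| + ε) * ‖v‖)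
      ((hdc.abs.add continuous_const).mul continuous_const) 1
    have b2i := hint (fun t => (η t + ε) * ‖f‖) ((hηc.add continuous_const).mul continuous_const) 1
    have b3i := hint (fun t => (η t + ε) * F) ((hηc.add continuous_const).mul continuous_const) 2
    have b1 := norm_integral_le_setIntegral (g := fun t => deriv φ t * inner ℝ (u t) v)
      measurableSet_Icc b1i (fun t ht => by rw [hφz' t ht, zero_mul]) (.of_forall fun t ht => by
        rw [abs_mul, pow_one, hUu t ht.1, mul_assoc, mul_comm ‖v‖]
        exact mul_le_mul (hφle' t) (abs_real_inner_le_norm _ _) (abs_nonneg _)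
          (by positivity))
    have hV := (ae_restrict_iff' measurableSet_Ioi).1 hu.mem_V
    have b2 := norm_integral_le_setIntegral
      (g := fun t => φ t * inner ℝ (stokesPow (1 / 2) (u t)) (stokesPow (1 / 2) v))
      measurableSet_Icc b2i (fun t ht => by rw [hφz t ht, zero_mul]) (by
        filter_upwards [hV] with t hVt ht
        by_cases h0 : t ∈ tsupport φ
        · rw [hv, inner_half_half_neg_one hfH (hVt (hφ0 h0)), abs_mul, pow_one, hUu t ht.1,
            mul_assoc, mul_comm ‖f‖]
          exact mul_le_mul (hφle t) (abs_real_inner_le_norm _ _) (abs_nonneg _)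
            (by linarith [hη.nonneg t])
        · rw [image_eq_zero_of_notMem_tsupport h0, zero_mul, abs_zero]
          have := hη.nonneg t
          have := hU0 t
          positivity)
    have b3 := norm_integral_le_setIntegral (g := fun t => φ t * trilinear (u t) v (u t))
      measurableSet_Icc b3i (fun t ht => by rw [hφz t ht, zero_mul]) (.of_forall fun t ht => by
        rw [abs_mul, hUu t ht.1, mul_assoc]
        exact mul_le_mul (hφle t) (abs_trilinear_le hCA.le hagmon hf (u t)) (abs_nonneg _)
          (by linarith [hη.nonneg t]))
    have b4 : (∫ t in J, η t) - ε * (T + 1) ≤ ∫ t, φ t := by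
      have e : ∫ t, φ t = ∫ t in J, φ t :=
        (setIntegral_eq_integral_of_forall_compl_eq_zero fun t ht => hφz t ht).symm
      have e' : (∫ t in J, η t) - ε * (T + 1) = ∫ t in J, (η t - ε) := by
        rw [integral_sub hηc.integrableOn_Icc (integrable_const _), integral_const,
          measureReal_restrict_apply_univ, hvol, smul_eq_mul, mul_comm]
      rw [e, e']
      refine setIntegral_mono (hηc.integrableOn_Icc.sub (integrable_const _))
        hφ.continuous.integrableOn_Icc fun t => ?_
      linarith [(abs_le.1 (hφη t).1).1]
    have b5 : (∫ t in J, (|deriv η t| + ε) * ‖v‖ * U t ^ 1)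
        + ν * (∫ t in J, (η t + ε) * ‖f‖ * U t ^ 1) + ∫ t in J, (η t + ε) * F * U t ^ 2
        ≤ B + (T + 1) * (‖v‖ * M + ν * ‖f‖ * M + F * M ^ 2) * ε := by
      have e : (T + 1) * (‖v‖ * M + ν * ‖f‖ * M + F * M ^ 2) * ε
          = ∫ t in J, (‖v‖ * M + ν * ‖f‖ * M + F * M ^ 2) * ε := by
        rw [integral_const, measureReal_restrict_apply_univ, hvol, smul_eq_mul, mul_assoc]
      have b12i : IntegrableOn (fun t => (|deriv η t| + ε) * ‖v‖ * U t ^ 1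
          + ν * ((η t + ε) * ‖f‖ * U t ^ 1)) J := b1i.add (b2i.const_mul ν)
      rw [e, hB, ← integral_add hBint (integrable_const _), ← integral_const_mul,
        ← integral_add b1i (b2i.const_mul ν), ← integral_add b12i b3i]
      refine setIntegral_mono (b12i.add b3i)
        (hBint.add (integrable_const _)) fun t => ?_
      have hηδ : η t ≤ η t ^ δ := by
        simpa using Real.rpow_le_rpow_of_exponent_ge' (hη.nonneg t) (hη.le_one t) hδ.le hδ1.le
      have h1 : |deriv η t| * (‖v‖ * U t) ≤ C₀ / T * η t ^ δ * (‖v‖ * U t) :=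
        mul_le_mul_of_nonneg_right (hη.deriv_bound t) (mul_nonneg (norm_nonneg _) (hU0 t))
      have h2 : η t * (ν * ‖f‖ * U t) ≤ η t ^ δ * (ν * ‖f‖ * U t) :=
        mul_le_mul_of_nonneg_right hηδ (by have := hU0 t; positivity)
      have h3 : η t * (F * U t ^ 2) ≤ η t ^ δ * (F * U t ^ 2) :=
        mul_le_mul_of_nonneg_right hηδ (by positivity)
      have h4 : ε * (‖v‖ * U t + ν * ‖f‖ * U t + F * U t ^ 2)
          ≤ ε * (‖v‖ * M + ν * ‖f‖ * M + F * M ^ 2) := by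
        have := hUM t
        have := hU0 t
        gcongr
      rw [hγ]
      simp only [pow_one]
      linarith
    have hDφ := mul_le_mul_of_nonneg_left b4 (by positivity : 0 ≤ D)
    have c1 := (abs_le.1 b1).1
    have c2 := mul_le_mul_of_nonneg_left (abs_le.1 b2).2 hν.le
    have c3 := (abs_le.1 b3).1
    rw [hK]
    linarith
  have hfin : D * ∫ t in J, η t ≤ B := by
    refine le_of_forall_pos_le_add fun ε hε => ?_
    have hK0 : 0 ≤ K := by positivity
    have hden : 0 < (T + 1) * K + 1 := by positivity
    refine (key (ε / ((T + 1) * K + 1)) (by positivity)).trans (add_le_add_right ?_ _)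
    rw [mul_div_assoc', div_le_iff₀ hden]
    nlinarith
  have hz : ∀ t, T < t → η t = 0 := fun t ht =>
    eq_zero_of_tsupport_subset_Icc hη.support fun h => absurd h.2 (not_le.2 ht)
  have hzδ : ∀ t, T < t → η t ^ δ = 0 := fun t ht => by rw [hz t ht, Real.zero_rpow hδ.ne']
  rw [setIntegral_Icc_eq_intervalIntegral hT.le (by linarith) hz, hB,
    setIntegral_Icc_eq_intervalIntegral hT.le (by linarith)
      (fun t ht => by rw [hzδ t ht]; ring)] at hfin
  refine hfin.trans_eq ?_
  have i1 := (hu.intervalIntegrable_norm_pow 1 le_rfl hT.le).continuousOn_mul hδc.continuousOn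
  have i2 := (hu.intervalIntegrable_norm_pow 2 le_rfl hT.le).continuousOn_mul hδc.continuousOn
  simp only [pow_one] at i1
  rw [← intervalIntegral.integral_const_mul, ← intervalIntegral.integral_const_mul,
    ← intervalIntegral.integral_add (i1.const_mul _) (i2.const_mul _)]
  refine intervalIntegral.integral_congr fun t ht => ?_
  rw [uIcc_of_le hT.le] at ht
  simp only [hUu t ht.1]
  ring

end LerayHopf

/-! ### The dissipation and energy estimates in terms of the root mean square velocity. -/

section Bounds

variable {L : ℝ} [Fact (0 < L)] {ν C₀ δ T R₀ C_A : ℝ} {η : ℝ → ℝ} {f : VecField L}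
  {u : ℝ → VecField L}

/-- The mean square velocity `(T⁻¹ ∫ η^δ ‖u‖²)^{1/2}`. -/
def rmsNorm (T δ : ℝ) (η : ℝ → ℝ) (u : ℝ → VecField L) : ℝ :=
  √((∫ t in (0 : ℝ)..T, η t ^ δ * ‖u t‖ ^ 2) / T)

lemma rmsNorm_nonneg : 0 ≤ rmsNorm T δ η u := Real.sqrt_nonneg _

lemma IsTimeCutoff.rpow_nonneg (hη : IsTimeCutoff C₀ δ T η) (t : ℝ) : 0 ≤ η t ^ δ :=
  Real.rpow_nonneg (hη.nonneg t) _

lemma IsTimeCutoff.rpow_le_one (hη : IsTimeCutoff C₀ δ T η) (hδ : 0 < δ) (t : ℝ) : η t ^ δ ≤ 1 :=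
  Real.rpow_le_one (hη.nonneg t) (hη.le_one t) hδ.le

lemma IsTimeCutoff.le_rpow (hη : IsTimeCutoff C₀ δ T η) (hδ : 0 < δ) (hδ1 : δ < 1) (t : ℝ) :
    η t ≤ η t ^ δ := by
  simpa using Real.rpow_le_rpow_of_exponent_ge' (hη.nonneg t) (hη.le_one t) hδ.le hδ1.le

lemma IsTimeCutoff.continuous_rpow (hη : IsTimeCutoff C₀ δ T η) (hδ : 0 < δ) :
    Continuous fun t => η t ^ δ :=
  hη.contDiff.continuous.rpow_const fun _ => Or.inr hδ.le

lemma integral_rpow_mul_norm_sq (hη : IsTimeCutoff C₀ δ T η) (hT : 0 < T) :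
    ∫ t in (0 : ℝ)..T, η t ^ δ * ‖u t‖ ^ 2 = T * rmsNorm T δ η u ^ 2 := by
  have h : 0 ≤ ∫ t in (0 : ℝ)..T, η t ^ δ * ‖u t‖ ^ 2 :=
    intervalIntegral.integral_nonneg hT.le fun t _ =>
      mul_nonneg (hη.rpow_nonneg t) (sq_nonneg _)
  rw [rmsNorm, Real.sq_sqrt (by positivity)]
  field_simp

lemma energy_eq (hη : IsTimeCutoff C₀ δ T η) (hT : 0 < T) :
    energy R₀ T δ η u = rmsNorm T δ η u ^ 2 / (2 * R₀ ^ 3) := by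
  have : ∫ t in (0 : ℝ)..T, η t ^ δ * (‖u t‖ ^ 2 / 2) = T * rmsNorm T δ η u ^ 2 / 2 := by
    rw [← integral_rpow_mul_norm_sq hη hT, ← intervalIntegral.integral_div]
    simp only [mul_div_assoc]
  rw [energy, this]
  field_simp

/-- Cauchy–Schwarz in time, obtained by integrating the square of `η^δ ‖u‖` minus its mean; `η^{2δ}
≤ η^δ` restores the weight. -/
lemma integral_rpow_mul_norm_le (hu : IsLerayHopf ν f 0 u) (hη : IsTimeCutoff C₀ δ T η)
    (hδ : 0 < δ) (hT : 0 < T) :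
    ∫ t in (0 : ℝ)..T, η t ^ δ * ‖u t‖ ≤ T * rmsNorm T δ η u := by
  have hc := hη.continuous_rpow hδ
  have i1 := (hu.intervalIntegrable_norm_pow 1 le_rfl hT.le).continuousOn_mul hc.continuousOn
  have i2 := (hu.intervalIntegrable_norm_pow 2 le_rfl hT.le).continuousOn_mul hc.continuousOn
  simp only [pow_one] at i1
  set A := ∫ t in (0 : ℝ)..T, η t ^ δ * ‖u t‖ with hA
  have h : ∫ t in (0 : ℝ)..T, (2 * (A / T) * (η t ^ δ * ‖u t‖) - (A / T) ^ 2)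
      ≤ ∫ t in (0 : ℝ)..T, η t ^ δ * ‖u t‖ ^ 2 := by
    refine intervalIntegral.integral_mono_on hT.le ((i1.const_mul _).sub intervalIntegrable_const)
      i2 fun t _ => ?_
    have h1 : (η t ^ δ * ‖u t‖) ^ 2 ≤ η t ^ δ * ‖u t‖ ^ 2 := by
      rw [mul_pow, sq (η t ^ δ), mul_assoc]
      exact mul_le_of_le_one_left (mul_nonneg (hη.rpow_nonneg t) (sq_nonneg _))
        (hη.rpow_le_one hδ t)
    nlinarith [sq_nonneg (η t ^ δ * ‖u t‖ - A / T)]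
  rw [intervalIntegral.integral_sub (i1.const_mul _) intervalIntegrable_const,
    intervalIntegral.integral_const_mul, ← hA, integral_rpow_mul_norm_sq hη hT,
    intervalIntegral.integral_const, smul_eq_mul, sub_zero] at h
  have h2 : 2 * (A / T) * A - T * (A / T) ^ 2 = T * (A / T) ^ 2 := by
    field_simp; ring
  rw [h2] at h
  have h3 : A / T ≤ rmsNorm T δ η u :=
    le_of_sq_le_sq (le_of_mul_le_mul_left h hT) rmsNorm_nonneg
  rwa [div_le_iff₀' hT] at h3

lemma rmsNorm_le (hu : IsLerayHopf ν f 0 u) (hη : IsTimeCutoff C₀ δ T η) (hδ : 0 < δ)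
    (hT : 0 < T) {g : ℝ} (hg : 0 ≤ g) (h : ∀ t ∈ Icc 0 T, ‖u t‖ ≤ g) : rmsNorm T δ η u ≤ g := by
  refine le_of_sq_le_sq (le_of_mul_le_mul_left ?_ hT) hg
  rw [← integral_rpow_mul_norm_sq hη hT]
  have i2 := (hu.intervalIntegrable_norm_pow 2 le_rfl hT.le).continuousOn_mul
    (hη.continuous_rpow hδ).continuousOn
  have := intervalIntegral.integral_mono_on hT.le i2 (intervalIntegrable_const (c := g ^ 2))
    fun t ht => by
      exact (mul_le_of_le_one_left (sq_nonneg _) (hη.rpow_le_one hδ t)).trans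
        (pow_le_pow_left₀ (norm_nonneg _) (h t ht) 2)
  simpa using this

lemma dissipation_le_rmsNorm (hu : IsLerayHopf ν f 0 u) (hη : IsTimeCutoff C₀ δ T η)
    (hδ : 0 < δ) (hδ1 : δ < 1) (hT : 0 < T) (hR : 0 < R₀) :
    dissipation ν R₀ T f η u
      ≤ (C₀ / T * (rmsNorm T δ η u ^ 2 / 2) + ‖f‖ * rmsNorm T δ η u) / R₀ ^ 3 := by
  have hδc := hη.continuous_rpow hδ
  have hdc : Continuous (deriv η) := hη.contDiff.continuous_deriv le_rfl
  have n1 := hu.intervalIntegrable_norm_pow 1 le_rfl hT.le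
  have n2 := hu.intervalIntegrable_norm_pow 2 le_rfl hT.le
  simp only [pow_one] at n1
  have h1 : ∫ t in (0 : ℝ)..T, deriv η t * (‖u t‖ ^ 2 / 2)
      ≤ C₀ / T * (T * rmsNorm T δ η u ^ 2 / 2) := by
    rw [← integral_rpow_mul_norm_sq hη hT, ← intervalIntegral.integral_div,
      ← intervalIntegral.integral_const_mul]
    refine intervalIntegral.integral_mono_on hT.le
      ((n2.div_const 2).continuousOn_mul hdc.continuousOn)
      (((n2.continuousOn_mul hδc.continuousOn).div_const 2).const_mul _) fun t _ => ?_
    have := mul_le_mul_of_nonneg_right ((le_abs_self _).trans (hη.deriv_bound t))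
      (by positivity : 0 ≤ ‖u t‖ ^ 2 / 2)
    exact this.trans_eq (by ring)
  have h2 : ∫ t in (0 : ℝ)..T, η t * inner ℝ f (u t) ≤ ‖f‖ * (T * rmsNorm T δ η u) := by
    refine le_trans ?_ (mul_le_mul_of_nonneg_left (integral_rpow_mul_norm_le hu hη hδ hT)
      (norm_nonneg f))
    rw [← intervalIntegral.integral_const_mul]
    refine intervalIntegral.integral_mono_on hT.le
      ((hu.intervalIntegrable_inner f le_rfl hT.le).continuousOn_mul
        hη.contDiff.continuous.continuousOn)
      ((n1.continuousOn_mul hδc.continuousOn).const_mul _) fun t _ => ?_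
    calc η t * inner ℝ f (u t) ≤ η t * (‖f‖ * ‖u t‖) :=
          mul_le_mul_of_nonneg_left (real_inner_le_norm _ _) (hη.nonneg t)
      _ ≤ η t ^ δ * (‖f‖ * ‖u t‖) :=
          mul_le_mul_of_nonneg_right (hη.le_rpow hδ hδ1 t) (by positivity)
      _ = _ := by ring
  -- The viscous term cancels, leaving only the right-hand side of the energy balance.
  rw [dissipation, anomalousDissipation, add_sub_cancel, ← mul_add]
  calc 1 / T * (1 / R₀ ^ 3) * _
      ≤ 1 / T * (1 / R₀ ^ 3) * (C₀ / T * (T * rmsNorm T δ η u ^ 2 / 2)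
          + ‖f‖ * (T * rmsNorm T δ η u)) :=
        mul_le_mul_of_nonneg_left (add_le_add h1 h2) (by positivity)
    _ = _ := by field_simp

lemma IsTimeCutoff.cEta_pos (hη : IsTimeCutoff C₀ δ T η) (h0 : η ≠ 0) (hT : 0 < T) :
    0 < cEta T η := by
  obtain ⟨s, hs⟩ := Function.ne_iff.mp h0
  have hsT : s ∈ Icc 0 T := by
    by_contra h
    exact hs (eq_zero_of_tsupport_subset_Icc hη.support h)
  have := intervalIntegral.integral_pos hT hη.contDiff.continuous.continuousOn
    (fun t _ => hη.nonneg t) ⟨s, hsT, lt_of_le_of_ne (hη.nonneg s) (Ne.symm hs)⟩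
  rw [cEta]
  positivity

/-- The elementary dichotomy behind the lower bound on the energy. -/
lemma le_sq_of_quadratic {D P F x : ℝ} (hD : 0 < D) (hF : 0 < F)
    (h : D ≤ P * x + F * x ^ 2) (hPF : 2 * P ^ 2 ≤ D * F) : D / (2 * F) ≤ x ^ 2 := by
  by_contra! hcon
  have h1 : F * x ^ 2 < D / 2 := by
    rw [lt_div_iff₀ (by positivity)] at hcon
    linarith
  -- `(Px)² ≤ (DF/2) · (D/(2F)) = (D/2)²`; together with the strict bound on `F x²` this contradicts
  -- `h`.
  have h2 : P * x ≤ D / 2 := by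
    refine le_of_sq_le_sq ?_ (by positivity)
    have h3 : P ^ 2 * x ^ 2 ≤ D * F / 2 * x ^ 2 :=
      mul_le_mul_of_nonneg_right (by linarith) (sq_nonneg _)
    nlinarith
  linarith

lemma rpow_three_half {x : ℝ} (hx : 0 ≤ x) : x ^ (3 / 2 : ℝ) = (x ^ (1 / 2 : ℝ)) ^ 3 := by
  rw [← Real.rpow_mul_natCast hx]; norm_num

lemma rpow_five_half {x : ℝ} (hx : 0 ≤ x) : x ^ (5 / 2 : ℝ) = (x ^ (1 / 2 : ℝ)) ^ 5 := by
  rw [← Real.rpow_mul_natCast hx]; norm_num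

lemma rpow_half_sq {x : ℝ} (hx : 0 ≤ x) : (x ^ (1 / 2 : ℝ)) ^ 2 = x := by
  rw [← Real.sqrt_eq_rpow, Real.sq_sqrt hx]

/-- The upper bound for the dissipation in terms of the energy. -/
lemma dissipation_le (hu : IsLerayHopf ν f 0 u) (hη : IsTimeCutoff C₀ δ T η)
    (hδ : 0 < δ) (hδ1 : δ < 1) (hν : 0 < ν) (hC₀ : 0 < C₀) (hT : 0 < T) (hR : 0 < R₀)
    (hL : L = 4 * R₀) (hatt : ∀ t ∈ Icc 0 T, u t ∈ weakAttractor ν f)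
    (hT1 : T ≥ 2 * C₀ / Real.pi ^ 2 * (R₀ ^ 2 / ν)) :
    dissipation ν R₀ T f η u
      ≤ 2 * √2 * (‖f‖ / R₀ ^ (3 / 2 : ℝ)) * energy R₀ T δ η u ^ (1 / 2 : ℝ) := by
  have hpi := Real.pi_pos
  set x := rmsNorm T δ η u with hx
  have hx0 : 0 ≤ x := rmsNorm_nonneg
  have hxle : x ≤ ‖f‖ / (ν * (2 * Real.pi / L) ^ 2) :=
    rmsNorm_le hu hη hδ hT (by positivity)
      fun t ht => norm_le_of_mem_weakAttractor hν (hatt t ht)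
  -- With `L = 4R₀` the spectral gap is `π²/(4R₀²)`, and the constant `2C₀/π²` in the condition on
  -- `T` is exactly what this needs.
  have hxle' : C₀ / T * (x / 2) ≤ ‖f‖ := by
    have e : ‖f‖ / (ν * (2 * Real.pi / L) ^ 2) = ‖f‖ * (4 * R₀ ^ 2 / (ν * Real.pi ^ 2)) := by
      have e0 : (2 * Real.pi / L) ^ 2 = Real.pi ^ 2 / (4 * R₀ ^ 2) := by
        rw [hL]; field_simp; norm_num
      rw [e0]
      field_simp
    have h1 : C₀ * (2 * R₀ ^ 2 / (ν * Real.pi ^ 2)) ≤ T := by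
      refine le_trans (le_of_eq ?_) hT1
      field_simp
    rw [div_mul_eq_mul_div, div_le_iff₀ hT]
    rw [e] at hxle
    calc C₀ * (x / 2) ≤ C₀ * (‖f‖ * (4 * R₀ ^ 2 / (ν * Real.pi ^ 2)) / 2) := by gcongr
      _ = ‖f‖ * (C₀ * (2 * R₀ ^ 2 / (ν * Real.pi ^ 2))) := by ring
      _ ≤ ‖f‖ * T := by gcongr
  have h := dissipation_le_rmsNorm hu hη hδ hδ1 hT hR
  rw [← hx] at h
  have hr := rpow_half_sq hR.le
  have hr0 : 0 < R₀ ^ (1 / 2 : ℝ) := Real.rpow_pos_of_pos hR _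
  have he : energy R₀ T δ η u ^ (1 / 2 : ℝ) = x / (√2 * (R₀ ^ (1 / 2 : ℝ)) ^ 3) := by
    rw [energy_eq hη hT, ← hx, ← Real.sqrt_eq_rpow, Real.sqrt_div (sq_nonneg _),
      Real.sqrt_sq hx0, Real.sqrt_mul zero_le_two]
    congr 2
    rw [← rpow_three_half hR.le, Real.sqrt_eq_rpow, ← Real.rpow_natCast_mul hR.le]
    norm_num
  rw [he, rpow_three_half hR.le]
  refine h.trans ?_
  have h2 : C₀ / T * (x ^ 2 / 2) ≤ ‖f‖ * x := by
    calc C₀ / T * (x ^ 2 / 2) = C₀ / T * (x / 2) * x := by ring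
      _ ≤ ‖f‖ * x := by gcongr
  have h3 : 2 * √2 * (‖f‖ / (R₀ ^ (1 / 2 : ℝ)) ^ 3) * (x / (√2 * (R₀ ^ (1 / 2 : ℝ)) ^ 3))
      = 2 * (‖f‖ * x) / R₀ ^ 3 := by
    have : R₀ ^ 3 = (R₀ ^ (1 / 2 : ℝ)) ^ 3 * (R₀ ^ (1 / 2 : ℝ)) ^ 3 := by
      conv_lhs => rw [← hr]
      ring
    rw [this]
    field_simp
  rw [h3]
  gcongr
  linarith

lemma thetaF_pos (hc : 0 < cEta T η) (hR : 0 < R₀) (hCA : 0 < C_A)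
    (hf : f ∈ stokesDom L (1 / 2)) (hf0 : f ≠ 0) : 0 < thetaF R₀ C_A T η f := by
  have h1 : 0 < ‖f‖ := norm_pos_iff.2 hf0
  have h2 : 0 < ‖stokesPow (1 / 2) f‖ := norm_pos_iff.2 (stokesPow_ne_zero hf hf0)
  have h3 : 0 < ‖stokesPow (-(1 / 2)) f‖ := norm_pos_iff.2
    (stokesPow_ne_zero (mem_stokesDom_of_nonpos (by norm_num) (mem_H_of_mem_stokesDom hf)) hf0)
  rw [thetaF]
  positivity

/-- The lower bound for the energy. -/
lemma le_energy (hu : IsLerayHopf ν f 0 u) (hη : IsTimeCutoff C₀ δ T η)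
    (hδ : 0 < δ) (hδ1 : δ < 1) (hν : 0 < ν) (hC₀ : 0 < C₀) (hT : 0 < T) (hR : 0 < R₀)
    (hc : 0 < cEta T η) (hCA : 0 < C_A) (hagmon : AgmonInequality L C_A)
    (hf : f ∈ stokesDom L (1 / 2)) (hf0 : f ≠ 0) (hσ : ‖f‖ ≥ sigmaF ν C₀ C_A T η f) :
    energy R₀ T δ η u ≥ thetaF R₀ C_A T η f * (‖f‖ / R₀ ^ (1 / 2 : ℝ)) := by
  have hf1 : 0 < ‖f‖ := norm_pos_iff.2 hf0
  have hf2 : 0 < ‖stokesPow (1 / 2) f‖ := norm_pos_iff.2 (stokesPow_ne_zero hf hf0)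
  have hf3 : 0 < ‖stokesPow (-(1 / 2)) f‖ := norm_pos_iff.2
    (stokesPow_ne_zero (mem_stokesDom_of_nonpos (by norm_num) (mem_H_of_mem_stokesDom hf)) hf0)
  have h := weak_form_bound hu hη hν hC₀ hδ hδ1 hT hCA hagmon hf hf0
  have hγ0 : 0 ≤ gammaF ν C₀ T f := by rw [gammaF]; positivity
  have hA := integral_rpow_mul_norm_le hu hη hδ hT
  rw [integral_rpow_mul_norm_sq hη hT] at h
  rw [energy_eq hη hT]
  have hηc : ∫ t in (0 : ℝ)..T, η t = T * cEta T η := by rw [cEta]; field_simp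
  rw [hηc] at h
  rw [thetaF, rpow_three_half hf1.le, rpow_five_half hR.le]
  rw [sigmaF] at hσ
  have ea := rpow_half_sq hf1.le
  have er := rpow_half_sq hR.le
  have ha0 : 0 < ‖f‖ ^ (1 / 2 : ℝ) := Real.rpow_pos_of_pos hf1 _
  have hb0 : 0 < ‖stokesPow (1 / 2) f‖ ^ (1 / 2 : ℝ) := Real.rpow_pos_of_pos hf2 _
  have hr0 : 0 < R₀ ^ (1 / 2 : ℝ) := Real.rpow_pos_of_pos hR _
  set a := ‖f‖ ^ (1 / 2 : ℝ)
  set b := ‖stokesPow (1 / 2) f‖ ^ (1 / 2 : ℝ)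
  set r := R₀ ^ (1 / 2 : ℝ)
  set c := cEta T η
  set x := rmsNorm T δ η u
  set γ := gammaF ν C₀ T f
  set d := ‖stokesPow (-(1 / 2)) f‖ ^ 2 with hd
  have hd0 : 0 < d := by positivity
  have hx0 : 0 ≤ x := rmsNorm_nonneg
  have hq : c * d ≤ ν * γ * ‖f‖ * x + C_A * (a * b) * x ^ 2 := by
    have h1 : ν * γ * ‖f‖ * (∫ t in (0 : ℝ)..T, η t ^ δ * ‖u t‖) ≤ ν * γ * ‖f‖ * (T * x) :=
      mul_le_mul_of_nonneg_left hA (by positivity)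
    refine le_of_mul_le_mul_left ?_ hT
    linarith
  -- This is `‖f‖ ≥ σ_f` with denominators cleared, using `‖f‖ = a²`.
  have hPF : 2 * (ν * γ * ‖f‖) ^ 2 ≤ c * d * (C_A * (a * b)) := by
    have e : 2 * γ ^ 2 * ν ^ 2 / (c * C_A) * (a / b) * (‖f‖ ^ 2 / d)
        = 2 * (ν * γ * ‖f‖) ^ 2 * a / (c * d * (C_A * b)) := by
      field_simp
    rw [e, ge_iff_le, div_le_iff₀ (by positivity)] at hσ
    refine le_of_mul_le_mul_right (hσ.trans_eq ?_) ha0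
    rw [← ea]
    ring
  have hmain := le_sq_of_quadratic (by positivity) (by positivity) hq hPF
  have e : c / (4 * C_A) * (1 / r ^ 5) * (d / (a ^ 3 * b)) * (‖f‖ / r)
      = c * d / (2 * (C_A * (a * b))) / (2 * R₀ ^ 3) := by
    rw [← ea, ← er]
    field_simp
    norm_num
  rw [e, ge_iff_le]
  gcongr

end Bounds

end NSE

end

theorem theorem4 :
    (∃ C : ℝ, 0 < C ∧ ∀ (L : ℝ) [Fact (0 < L)], NSE.AgmonInequality L C) ∧
    ∀ (L : ℝ) [Fact (0 < L)] (R₀ ν C₀ δ T C_A : ℝ) (η : ℝ → ℝ)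
      (f : NSE.VecField L) (u : ℝ → NSE.VecField L),
      L = 4 * R₀ → 0 < ν → 0 < C₀ → 1 / 2 < δ → δ < 1 →
      0 < C_A → NSE.AgmonInequality L C_A →
      NSE.IsTimeCutoff C₀ δ T η → η ≠ 0 →
      f ∈ NSE.stokesDom L (1 / 2) → f ≠ 0 →
      NSE.IsLerayHopf ν f 0 u →
      (∀ t ∈ Set.Icc 0 T, u t ∈ NSE.weakAttractor ν f) →
      ‖f‖ ≥ NSE.sigmaF ν C₀ C_A T η f →
      T ≥ 2 * C₀ / Real.pi ^ 2 * (R₀ ^ 2 / ν) →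
      0 ≤ NSE.anomalousDissipation ν R₀ T f η u ∧
      NSE.dissipation ν R₀ T f η u
        ≤ 2 * √2 * (‖f‖ / R₀ ^ (3 / 2 : ℝ)) * NSE.energy R₀ T δ η u ^ (1 / 2 : ℝ) ∧
      NSE.energy R₀ T δ η u ≥ NSE.thetaF R₀ C_A T η f * (‖f‖ / R₀ ^ (1 / 2 : ℝ)) ∧
      NSE.dissipation ν R₀ T f η u
        ≤ 2 * √2 / NSE.thetaF R₀ C_A T η f * (NSE.energy R₀ T δ η u ^ (3 / 2 : ℝ) / R₀) := by
  refine ⟨⟨33, by norm_num, fun L _ => NSE.agmonInequality L⟩, ?_⟩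
  intro L _ R₀ ν C₀ δ T C_A η f u hL hν hC₀ hδ2 hδ1 hCA hagmon hη hη0 hf hf0 hu hatt hσ hT1
  have hL0 : 0 < L := Fact.out
  have hR : 0 < R₀ := by linarith
  have hδ : 0 < δ := by linarith
  have hT : 0 < T := lt_of_lt_of_le (by have := Real.pi_pos; positivity) hT1
  have hc := hη.cEta_pos hη0 hT
  have hdiss := NSE.dissipation_le hu hη hδ hδ1 hν hC₀ hT hR hL hatt hT1
  have hen := NSE.le_energy hu hη hδ hδ1 hν hC₀ hT hR hc hCA hagmon hf hf0 hσ
  refine ⟨NSE.anomalousDissipation_nonneg hu hη hν hC₀ hδ hT hR, hdiss, hen, hdiss.trans ?_⟩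
  have hθ := NSE.thetaF_pos hc hR hCA hf hf0
  have he0 : 0 ≤ NSE.energy R₀ T δ η u := le_trans (by positivity) hen
  have hr0 : 0 < R₀ ^ (1 / 2 : ℝ) := Real.rpow_pos_of_pos hR _
  have er := NSE.rpow_half_sq hR.le
  have ee := NSE.rpow_half_sq he0
  have hs0 : 0 ≤ NSE.energy R₀ T δ η u ^ (1 / 2 : ℝ) := Real.rpow_nonneg he0 _
  rw [NSE.rpow_three_half hR.le, NSE.rpow_three_half he0]
  set θ := NSE.thetaF R₀ C_A T η f
  set r := R₀ ^ (1 / 2 : ℝ)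
  set s := NSE.energy R₀ T δ η u ^ (1 / 2 : ℝ)
  rw [← ee] at hen
  -- The lower energy bound read as an upper bound for `‖f‖`, to be inserted in the dissipation
  -- bound.
  have h1 : ‖f‖ / r ^ 3 ≤ s ^ 2 / (θ * r ^ 2) := by
    rw [ge_iff_le, mul_div_assoc', div_le_iff₀ hr0] at hen
    rw [div_le_div_iff₀ (by positivity) (by positivity)]
    have := mul_le_mul_of_nonneg_right hen (sq_nonneg r)
    linarith
  calc 2 * √2 * (‖f‖ / r ^ 3) * s ≤ 2 * √2 * (s ^ 2 / (θ * r ^ 2)) * s := by gcongr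
    _ = 2 * √2 / θ * (s ^ 3 / R₀) := by
      rw [← er]
      field_simp
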